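/- Let $K$ be a nonarchimedean local field with valuation ring $R$ and maximal ideal $\mathfrak p$, let $B$ be a finite-dimensional central simple $K$-algebra, and let $\mathcal O\subseteq B$ be a maximal $R$-order with Jacobson radical $J$. For a left ideal $P\subseteq\mathcal O$, let $\operatorname{nrd}(P)$ be the $R$-submodule of $K$ generated by the reduced norms of the elements of $P$, and let $\operatorname{Id}(\mathcal O;\mathfrak p)$ be the set of left ideals $P$ of $\mathcal O$ with $\operatorname{nrd}(P)=\mathfrak p$. (a) There are an integer $m\ge 1$, a division $K$-algebra $D$ with $B\simeq \operatorname{M}_m(D)$, a finite extension $\mathbb F_q$ of $R/\mathfrak p$, and a ring isomorphism $\mathcal O/J\simeq \operatorname{M}_m(\mathbb F_q)$ compatible with the maps from $R$. (b) For every $\omega\in\mathcal O^\times$, the map $\sigma_\omega: P\mapsto P\omega+\mathcal O\mathfrak p$ is a permutation of $\operatorname{Id}(\mathcal O;\mathfrak p)$. (c) Let $\mathcal O/J\simeq \operatorname{M}_m(\mathbb F_q)$ be any ring isomorphism with $\mathbb F_q$ a finite field, and let $\rho:\mathcal O\to \operatorname{M}_m(\mathbb F_q)$ be reduction modulo $J$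 followed by it, so that $\rho$ restricts to $\rho:\mathcal O^\times\to\operatorname{GL}_m(\mathbb F_q)$. For $P\in\operatorname{Id}(\mathcal O;\mathfrak p)$ one has $\rho(P)=\operatorname{M}_m(\mathbb F_q)A$ for some matrix $A$ of rank $m-1$, and $P\mapsto\kappa(P)=\ker A$ is a well-defined bijection $\kappa:\operatorname{Id}(\mathcal O;\mathfrak p)\to\mathbb P^{m-1}(\mathbb F_q)$. For $Q\in\operatorname{GL}_m(\mathbb F_q)$ let $\tau_Q$ be the permutation $v\mapsto Q^{-1}v$ of $\mathbb P^{m-1}(\mathbb F_q)$. Then for every $\omega\in\mathcal O^\times$ $$\kappa\circ\sigma_\omega\circ\kappa^{-1}=\tau_{\rho(\omega)},$$ that is, the diagram formed by $\sigma:\mathcal O^\times\to\operatorname{Sym}(\operatorname{Id}(\mathcal O;\mathfrak p))$, $\rho$, $\tau:\operatorname{GL}_m(\mathbb F_q)\to\operatorname{Sym}(\mathbb P^{m-1}(\mathbb F_q))$ and the bijection $\operatorname{Sym}(\operatorname{Id}(\mathcal O;\mathfrak p))\simeq\operatorname{Sym}(\mathbb P^{m-1}(\mathbb F_q))$ induced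 by $\kappa$ commutes. -/

import Mathlib

open ValuativeRel
open scoped TensorProduct LinearAlgebra.Projectivization

universe u v w

namespace Metacommutation

noncomputable section

section ReducedNorm

variable (K : Type u) [Field K] {B : Type v} [Ring B] [Algebra K B]

/-- `c` is the determinant of the image of `x` in a matrix algebra over some splitting field `L`
of the `K`-algebra `B`. -/
def IsReducedNorm (x : B) (c : K) : Prop :=
  ∃ (L : Type u) (_ : Field L) (_ : Algebra K L) (n : ℕ)
    (φ : (L ⊗[K] B) ≃ₐ[L] Matrix (Fin n) (Fin n) L),
    (φ (1 ⊗ₜ[K] x)).det = algebraMap K L c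

open Classical in
/-- The reduced norm `B → K` of a central simple algebra. By the Skolem-Noether theorem there is
exactly one `c` as in `IsReducedNorm`; it depends neither on the splitting field nor on the
isomorphism. -/
def reducedNorm (x : B) : K :=
  if h : ∃ c : K, IsReducedNorm K x c then h.choose else 0

end ReducedNorm

section Orders

variable (K : Type u) [Field K] [ValuativeRel K] {B : Type v} [Ring B] [Algebra K B]

/-- An order over the valuation ring `𝒪[K]` in `B`: a subring containing `𝒪[K]` that is finitely
generated as an `𝒪[K]`-module and spans `B` over `K`. -/
def IsOrder (O : Subalgebra 𝒪[K] B) : Prop :=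
  (Subalgebra.toSubmodule O).FG ∧ Submodule.span K (O : Set B) = ⊤

/-- An order that is not properly contained in another order. -/
def IsMaximalOrder (O : Subalgebra 𝒪[K] B) : Prop :=
  Maximal (IsOrder K) O

variable {K}

/-- The reduced norm of a left ideal `P` of `O`: the `𝒪[K]`-submodule of `K` generated by the
reduced norms of the elements of `P`. (For a noncommutative ring, `Ideal` means left ideal.) -/
def idealReducedNorm {O : Subalgebra 𝒪[K] B} (P : Ideal O) : Submodule 𝒪[K] K :=
  Submodule.span 𝒪[K] ((fun x : O => reducedNorm K (x : B)) '' (P : Set O))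

/-- The set of left ideals of `O` whose reduced norm is the maximal ideal of `𝒪[K]`. -/
def PrimeNormIdeals (O : Subalgebra 𝒪[K] B) : Set (Ideal O) :=
  {P | idealReducedNorm P = IsLocalization.coeSubmodule K 𝓂[K]}

/-- The left ideal `P ω + O 𝔭`, where `𝔭` is the maximal ideal of `𝒪[K]`. -/
def metacommute {O : Subalgebra 𝒪[K] B} (ω : O) (P : Ideal O) : Ideal O :=
  Submodule.map (LinearMap.toSpanSingleton O O ω) P ⊔ Ideal.map (algebraMap 𝒪[K] O) 𝓂[K]

/-- Reduction of `O` modulo its Jacobson radical, followed by an identification of the quotient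
with a matrix ring. -/
def reduction {O : Subalgebra 𝒪[K] B} {F : Type w} [Field F] {m : ℕ}
    (φ : (O ⧸ Ring.jacobson O) ≃+* Matrix (Fin m) (Fin m) F) :
    O →+* Matrix (Fin m) (Fin m) F :=
  φ.toRingHom.comp (Ideal.Quotient.mk (Ring.jacobson O))

/-- The reduction map on unit groups. -/
def unitsReduction {O : Subalgebra 𝒪[K] B} {F : Type w} [Field F] {m : ℕ}
    (φ : (O ⧸ Ring.jacobson O) ≃+* Matrix (Fin m) (Fin m) F) : Oˣ →* GL (Fin m) F :=
  Units.map (reduction φ : O →* Matrix (Fin m) (Fin m) F)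

end Orders

/-- The permutation `v ↦ Q⁻¹ v` of projective space. -/
def tau {F : Type w} [Field F] {m : ℕ} (Q : GL (Fin m) F) : Equiv.Perm (ℙ F (Fin m → F)) :=
  MulAction.toPerm Q⁻¹

theorem tau_mk {F : Type w} [Field F] {m : ℕ} (Q : GL (Fin m) F) (x : Fin m → F) (hx : x ≠ 0)
    (hx' : (Q⁻¹ : GL (Fin m) F).1.mulVec x ≠ 0) :
    tau Q (Projectivization.mk F x hx) =
      Projectivization.mk F ((Q⁻¹ : GL (Fin m) F).1.mulVec x) hx' :=
  rfl

end

end Metacommutation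

/-! Write `B ≃ M_m(D)` with `D` a central division algebra of index `n`. Composing the norm of `D`
with the valuation of `K` gives a valuation on `D`: by compactness the elements of integral norm
span a lattice, and an element stabilizing a lattice has integral norm. Its ring of integers `O_D`
has free lattices, so up to the choice of the isomorphism every maximal order is `M_m(O_D)`
(`IsMaximalOrder.exists_eq_integralMatrixOrder`). Its radical consists of the matrices with entries
in the maximal ideal of `O_D`, and the residue ring of `O_D` is a finite field by Wedderburn; this
is (a).

For (b) and (c), the left ideals of reduced norm `𝔭` are exactly the maximal left ideals
(`mem_primeNormIdeals_iff`). These contain `J`, and each is the annihilator of a unique line under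
any isomorphism of `O / J` with a matrix ring (`lineIdeal`). Each is generated by a unit multiple of
`diag(1, …, π, …, 1)`, and the crux is that this element has uniformizing reduced norm. If `N(π)`
has the valuation of `ϖ ^ f`, counting lattice indices gives a residue field of degree `f` over that
of `K`; a primitive element satisfies an equation of degree at most `n`, so `f ≤ n`. Since the norm
of `B` is the `mn`-th power of the reduced norm, this forces exponent `1`.

Finally `𝔭` lies in the radical, so `x ∈ P ω + O 𝔭` iff `x ω⁻¹ ∈ P`. Thus the line of `P` is moved
by `ρ(ω)⁻¹`. -/

namespace Metacommutation

noncomputable section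

open scoped Matrix

/-! ### Base change and splitting of central simple algebras. -/

section CentralSimple

variable (K : Type u) [Field K] (B : Type v) [Ring B] [Algebra K B]

/-- Submodules of `B` under two-sided multiplications are two-sided ideals. -/
theorem isSimpleModule_mulLeftRight_range [IsSimpleRing B] :
    IsSimpleModule (AlgHom.mulLeftRight K B).range B := by
  rw [isSimpleModule_iff_toSpanSingleton_surjective]
  refine ⟨inferInstance, fun x hx y ↦ ?_⟩
  have key : ∀ z : B, (∃ t, AlgHom.mulLeftRight K B t x = z) := by
    let I : TwoSidedIdeal B := TwoSidedIdeal.mk' {z | ∃ t, AlgHom.mulLeftRight K B t x = z}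
      ⟨0, by simp⟩
      (by rintro _ _ ⟨s, rfl⟩ ⟨t, rfl⟩; exact ⟨s + t, by simp⟩)
      (by rintro _ ⟨s, rfl⟩; exact ⟨-s, by simp⟩)
      (by rintro a _ ⟨s, rfl⟩; exact ⟨(a ⊗ₜ 1) * s, by simp⟩)
      (by rintro _ a ⟨s, rfl⟩; exact ⟨(1 ⊗ₜ MulOpposite.op a) * s, by simp⟩)
    have hmem : ∀ z, z ∈ I ↔ ∃ t, AlgHom.mulLeftRight K B t x = z := fun z ↦ by
      simp only [I]; rw [TwoSidedIdeal.mem_mk']; rfl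
    have hI : I = ⊤ := by
      refine (eq_bot_or_eq_top I).resolve_left fun h ↦ hx ?_
      have : x ∈ I := (hmem x).2 ⟨1, by simp⟩
      rw [h] at this
      simpa using this
    intro z
    rw [← hmem, hI]
    trivial
  obtain ⟨t, ht⟩ := key y
  exact ⟨⟨_, t, rfl⟩, ht⟩

/-- Endomorphisms of `B` commuting with all two-sided multiplications are scalars from the centre
`K`, so every `K`-linear `T` is linear over them. Jacobson density then matches `T` on a finite
spanning set. -/
theorem mulLeftRight_surjective [Algebra.IsCentral K B] [IsSimpleRing B] [Module.Finite K B] :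
    Function.Surjective (AlgHom.mulLeftRight K B) := by
  have := isSimpleModule_mulLeftRight_range K B
  intro T
  have hg : ∀ g : Module.End (AlgHom.mulLeftRight K B).range B, ∃ c : K, ∀ x, g x = c • x := by
    intro g
    have h (a b x : B) : g (a * x * b) = a * g x * b := by
      have := g.map_smul ⟨AlgHom.mulLeftRight K B (a ⊗ₜ MulOpposite.op b), _, rfl⟩ x
      simpa [Subalgebra.smul_def] using this
    have hz : g 1 ∈ Subalgebra.center K B := by
      rw [Subalgebra.mem_center_iff]
      intro b
      have h1 := h b 1 1
      have h2 := h 1 b 1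
      simp only [mul_one, one_mul] at h1 h2
      rw [← h1, ← h2]
    obtain ⟨c, hc⟩ := (Algebra.IsCentral.mem_center_iff K).1 hz
    refine ⟨c, fun x ↦ ?_⟩
    have h1 := h x 1 1
    simp only [mul_one] at h1
    rw [h1, hc, ← Algebra.commutes, Algebra.smul_def]
  obtain ⟨s, hs⟩ := Module.Finite.fg_top (R := K) (M := B)
  obtain ⟨⟨_, t, rfl⟩, hr⟩ := jacobson_density (R := (AlgHom.mulLeftRight K B).range) (M := B)
    { toFun := T
      map_add' := map_add T
      map_smul' := fun g x ↦ by
        obtain ⟨c, hc⟩ := hg g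
        rw [Module.End.smul_def, hc, map_smul, RingHom.id_apply, Module.End.smul_def, hc] } s
  refine ⟨t, LinearMap.ext_on hs fun x hx ↦ ?_⟩
  exact (hr x hx).symm

theorem baseChange_apply_of_mulLeftRight (L : Type w) [Field L] [Algebra K L] (s : B ⊗[K] Bᵐᵒᵖ) :
    ∃ t : (L ⊗[K] B) ⊗[L] (L ⊗[K] B)ᵐᵒᵖ, AlgHom.mulLeftRight L (L ⊗[K] B) t =
      (AlgHom.mulLeftRight K B s).baseChange L := by
  induction s with
  | zero => exact ⟨0, by simp⟩
  | add x y hx hy =>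
    obtain ⟨s, hs⟩ := hx
    obtain ⟨t, ht⟩ := hy
    exact ⟨s + t, by simp [hs, ht]⟩
  | tmul a b =>
    refine ⟨(1 ⊗ₜ a) ⊗ₜ MulOpposite.op (1 ⊗ₜ b.unop), ?_⟩
    ext x
    simp

variable (L : Type w) [Field L] [Algebra K L] [Algebra.IsCentral K B]
  [IsSimpleRing B] [Module.Finite K B]

theorem exists_mulLeftRight_eq_baseChange (T : Module.End K B) :
    ∃ t : (L ⊗[K] B) ⊗[L] (L ⊗[K] B)ᵐᵒᵖ, AlgHom.mulLeftRight L (L ⊗[K] B) t =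
      T.baseChange L := by
  obtain ⟨s, rfl⟩ := mulLeftRight_surjective K B T
  exact baseChange_apply_of_mulLeftRight K B L s

theorem mulLeftRight_mem {C : Type*} [Ring C] [Algebra K C] (I : TwoSidedIdeal C) {x : C}
    (hx : x ∈ I) (t : C ⊗[K] Cᵐᵒᵖ) : AlgHom.mulLeftRight K C t x ∈ I := by
  induction t with
  | zero => simp
  | add x y hx hy => simpa using I.add_mem hx hy
  | tmul a b => simpa using I.mul_mem_right _ _ (I.mul_mem_left _ _ hx)

theorem mulLeftRight_apply_of_mem_center {C : Type*} [Ring C] [Algebra K C] {x : C}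
    (hx : x ∈ Subalgebra.center K C) (t : C ⊗[K] Cᵐᵒᵖ) :
    AlgHom.mulLeftRight K C t x = x * AlgHom.mulLeftRight K C t 1 := by
  induction t with
  | zero => simp
  | add x y hx hy => simp [hx, hy, mul_add]
  | tmul a b => simp [Subalgebra.mem_center_iff.1 hx a, mul_assoc]

/-- A coordinate projection of `B` is a sum of two-sided multiplications, and stays so over `L`.
Applied to a nonzero `x` of an ideal, it produces in that ideal a nonzero scalar of `L`, hence a
unit. -/
instance isSimpleRing_baseChange : IsSimpleRing (L ⊗[K] B) := by
  have : Nontrivial B := inferInstance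
  refine ⟨⟨fun I ↦ or_iff_not_imp_left.2 fun hI ↦ ?_⟩⟩
  obtain ⟨x, hx, hx0⟩ : ∃ x ∈ I, x ≠ 0 := by
    by_contra! h
    exact hI (eq_bot_iff.2 fun x hx ↦ by simpa using h x hx)
  let b := Module.finBasis K B
  let bL := b.baseChange L
  obtain ⟨i, hi⟩ : ∃ i, bL.repr x i ≠ 0 := by
    by_contra! h
    exact hx0 (bL.repr.map_eq_zero_iff.1 (Finsupp.ext h))
  obtain ⟨t, ht⟩ := exists_mulLeftRight_eq_baseChange K B L ((b.coord i).smulRight (1 : B))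
  have hmem := mulLeftRight_mem L I hx t
  have hT : ((b.coord i).smulRight (1 : B)).baseChange L x = bL.repr x i ⊗ₜ[K] (1 : B) := by
    clear ht hx hi hx0 hmem
    induction x with
    | zero => simp
    | add x y hx hy => simp [hx, hy, TensorProduct.add_tmul]
    | tmul l y =>
      simp [bL, TensorProduct.smul_tmul']
  rw [ht, hT] at hmem
  rw [eq_top_iff]
  intro y _
  have := I.mul_mem_left (y * ((bL.repr x i)⁻¹ ⊗ₜ 1)) _ hmem
  rwa [mul_assoc, Algebra.TensorProduct.tmul_mul_tmul, inv_mul_cancel₀ hi, one_mul,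
    ← Algebra.TensorProduct.one_def, mul_one] at this

instance isCentral_baseChange : Algebra.IsCentral L (L ⊗[K] B) := by
  refine ⟨fun x hx ↦ ?_⟩
  -- The projection `y ↦ f(y) · 1` is a sum of two-sided multiplications fixing `1`. It therefore
  -- fixes every central `x`, while its image over `L` consists of scalars.
  obtain ⟨f, hf⟩ := Module.Projective.exists_dual_eq_one K (one_ne_zero (α := B))
  obtain ⟨t, ht⟩ := exists_mulLeftRight_eq_baseChange K B L (f.smulRight (1 : B))
  have h1 := mulLeftRight_apply_of_mem_center L hx t
  rw [ht] at h1
  have h2 : (f.smulRight (1 : B)).baseChange L 1 = 1 := by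
    rw [Algebra.TensorProduct.one_def]
    simp [hf]
  rw [h2, mul_one] at h1
  rw [← h1, Algebra.mem_bot]
  clear h1 hx
  induction x with
  | zero => exact ⟨0, by simp⟩
  | add x y hx hy =>
    obtain ⟨a, ha⟩ := hx
    obtain ⟨b, hb⟩ := hy
    exact ⟨a + b, by rw [map_add, map_add, ha, hb]⟩
  | tmul l y => exact ⟨f y • l, by simp [TensorProduct.smul_tmul']⟩

theorem isCentral_of_matrix (D : Type*) [Ring D] [Algebra K D] (m : ℕ) [NeZero m]
    (h : Algebra.IsCentral K (Matrix (Fin m) (Fin m) D)) : Algebra.IsCentral K D := by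
  refine ⟨fun x hx ↦ ?_⟩
  have : Matrix.scalarAlgHom (Fin m) K x ∈ Subalgebra.center K (Matrix (Fin m) (Fin m) D) := by
    rw [Matrix.subalgebraCenter_eq_scalarAlgHom_map]
    exact ⟨x, hx, rfl⟩
  obtain ⟨c, hc⟩ := (Algebra.IsCentral.mem_center_iff K).1 this
  refine ⟨c, ?_⟩
  have := congrFun (congrFun hc 0) 0
  simpa [Matrix.algebraMap_matrix_apply] using this.symm

/-- By Jacobson–Noether a noncommutative central division algebra contains a noncentral separable
element, which a separably closed field excludes. -/
theorem exists_algEquiv_matrix_of_isSepClosed (L : Type u) [Field L] [IsSepClosed L]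
    (C : Type v) [Ring C] [Algebra L C] [IsSimpleRing C] [Algebra.IsCentral L C]
    [FiniteDimensional L C] : ∃ n : ℕ, n ≠ 0 ∧ Nonempty (C ≃ₐ[L] Matrix (Fin n) (Fin n) L) := by
  have := IsArtinianRing.of_finite L C
  obtain ⟨n, hn, D, _, _, _, ⟨e⟩⟩ := IsSimpleRing.exists_algEquiv_matrix_divisionRing_finite L C
  have := isCentral_of_matrix L D n (Algebra.IsCentral.of_algEquiv L _ _ e)
  have htop : (⊥ : Subalgebra L D) = ⊤ := by
    by_contra h
    obtain ⟨x, hx, hsep⟩ := JacobsonNoether.exists_separable_and_not_isCentral' h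
    have hint : IsIntegral L x := Algebra.IsIntegral.isIntegral x
    have hdeg := IsSepClosed.degree_eq_one_of_irreducible L (minpoly.irreducible hint) hsep
    exact hx (minpoly.mem_range_of_degree_eq_one L x hdeg)
  have hb : Function.Bijective (Algebra.ofId L D) :=
    ⟨(algebraMap L D).injective, fun x ↦ by
      have : x ∈ (⊥ : Subalgebra L D) := htop ▸ trivial
      exact this⟩
  exact ⟨n, hn.out, ⟨e.trans (AlgEquiv.ofBijective (Algebra.ofId L D) hb).symm.mapMatrix⟩⟩

end CentralSimple

/-! ### The reduced norm: existence by Galois descent, and its relation to the norm. -/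

section ReducedNormLemmas

/-- Skolem–Noether: the automorphism is a conjugation. -/
theorem det_algEquiv_apply {L : Type*} [Field L] {n : ℕ}
    (ψ : Matrix (Fin n) (Fin n) L ≃ₐ[L] Matrix (Fin n) (Fin n) L) (A : Matrix (Fin n) (Fin n) L) :
    (ψ A).det = A.det := by
  let t : Matrix (Fin n) (Fin n) L ≃ₐ[L] Module.End L (Fin n → L) := Matrix.toLinAlgEquiv'
  obtain ⟨T, hT⟩ := ((t.symm.trans ψ).trans t).eq_linearEquivConjAlgEquiv
  have h : t (ψ A) = T.conj (t A) := by
    have := DFunLike.congr_fun hT (t A)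
    simp only [AlgEquiv.trans_apply, AlgEquiv.symm_apply_apply] at this
    rw [this]
    rfl
  have h2 (A) : (t A).det = A.det := LinearMap.det_toLin' A
  rw [← h2, h, LinearEquiv.conj_apply, LinearMap.comp_assoc, LinearMap.det_conj, h2]

theorem norm_matrix {L : Type*} [Field L] {n : ℕ} (A : Matrix (Fin n) (Fin n) L) :
    Algebra.norm L A = A.det ^ n := by
  let e : Matrix (Fin n) (Fin n) L ≃ₗ[L] (Fin n → Fin n → L) := Matrix.transposeLinearEquiv _ _ L L
  have h : (e : _ →ₗ[L] _) ∘ₗ Algebra.lmul L _ A ∘ₗ (e.symm : (Fin n → Fin n → L) →ₗ[L] _) =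
      LinearMap.pi fun i ↦ (Matrix.toLin' A) ∘ₗ LinearMap.proj i := by
    refine LinearMap.ext fun v ↦ ?_
    ext i j
    change (A * (Matrix.of v)ᵀ) j i = _
    simp [Matrix.mulVec, Matrix.mul_apply, dotProduct]
  rw [Algebra.norm_apply, ← LinearMap.det_conj _ e, h, LinearMap.det_pi]
  simp

theorem norm_algEquiv {L : Type*} [Field L] {A C : Type*} [Ring A] [Ring C] [Algebra L A]
    [Algebra L C] (e : A ≃ₐ[L] C) (x : A) : Algebra.norm L (e x) = Algebra.norm L x := by
  rw [Algebra.norm_apply, Algebra.norm_apply, ← LinearMap.det_conj _ e.toLinearEquiv]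
  congr 1
  refine LinearMap.ext fun v ↦ ?_
  simp

theorem algebraMap_norm_eq {K : Type*} [Field K] {B : Type*} [Ring B] [Algebra K B]
    [Module.Finite K B] (L : Type*) [Field L] [Algebra K L] (x : B) :
    algebraMap K L (Algebra.norm K x) = Algebra.norm L ((1 : L) ⊗ₜ[K] x) := by
  rw [Algebra.norm_apply, ← LinearMap.det_baseChange, Algebra.norm_apply]
  congr 1
  ext y
  simp

variable {K : Type u} [Field K] {B : Type v} [Ring B] [Algebra K B]

/-- Cayley–Hamilton over `L`, pushed down along a `K`-linear `f : L → K` with `f 1 = 1`, which keeps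
the leading coefficient. This bounds the residue degree later. -/
theorem exists_sum_pow_eq_zero_of_splitting {L : Type*} [Field L] [Algebra K L] {n : ℕ}
    (φ : (L ⊗[K] B) ≃ₐ[L] Matrix (Fin n) (Fin n) L) (x : B) :
    ∃ c : ℕ → K, c n = 1 ∧ ∑ i ∈ Finset.range (n + 1), c i • x ^ i = 0 := by
  obtain ⟨f, hf⟩ := Module.Projective.exists_dual_eq_one K (one_ne_zero (α := L))
  let A := φ (1 ⊗ₜ x)
  have h1 : ∑ i ∈ Finset.range (n + 1), A.charpoly.coeff i • (1 ⊗ₜ[K] x : L ⊗[K] B) ^ i = 0 := by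
    apply φ.injective
    have := A.aeval_self_charpoly
    rw [Polynomial.aeval_eq_sum_range, Matrix.charpoly_natDegree_eq_dim, Fintype.card_fin] at this
    simpa [A, -Algebra.TensorProduct.tmul_pow] using this
  refine ⟨fun i ↦ f (A.charpoly.coeff i), ?_, ?_⟩
  · have : A.charpoly.coeff n = 1 := by
      have := A.charpoly_monic.coeff_natDegree
      rwa [Matrix.charpoly_natDegree_eq_dim, Fintype.card_fin] at this
    simp [this, hf]
  · have h2 := congrArg (fun z ↦ TensorProduct.lid K B (f.rTensor B z)) h1
    simpa [Algebra.TensorProduct.tmul_pow, TensorProduct.smul_tmul'] using h2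

variable [Module.Finite K B]

theorem sq_eq_finrank_of_splitting {L : Type*} [Field L] [Algebra K L] {n : ℕ}
    (φ : (L ⊗[K] B) ≃ₐ[L] Matrix (Fin n) (Fin n) L) : n ^ 2 = Module.finrank K B := by
  have := φ.toLinearEquiv.finrank_eq
  rw [Module.finrank_baseChange, Module.finrank_matrix] at this
  simp [this, sq]

theorem IsReducedNorm.pow_eq_norm {x : B} {c : K} (h : IsReducedNorm K x c) {n : ℕ}
    (hn : n ^ 2 = Module.finrank K B) : c ^ n = Algebra.norm K x := by
  obtain ⟨L, _, _, k, φ, hφ⟩ := h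
  have hk := sq_eq_finrank_of_splitting φ
  obtain rfl : k = n := Nat.pow_left_injective (n := 2) (by norm_num) (hk.trans hn.symm)
  apply (algebraMap K L).injective
  rw [algebraMap_norm_eq, ← norm_algEquiv φ, norm_matrix, hφ, map_pow]

variable (K B) [Algebra.IsCentral K B] [IsSimpleRing B]

theorem exists_splitting : ∃ n : ℕ, n ≠ 0 ∧
    Nonempty ((SeparableClosure K ⊗[K] B) ≃ₐ[SeparableClosure K]
      Matrix (Fin n) (Fin n) (SeparableClosure K)) := by
  exact exists_algEquiv_matrix_of_isSepClosed (SeparableClosure K) (SeparableClosure K ⊗[K] B)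

variable {B}

theorem exists_isReducedNorm (x : B) : ∃ c, IsReducedNorm K x c := by
  obtain ⟨n, -, ⟨φ⟩⟩ := exists_splitting K B
  obtain ⟨c, hc⟩ : (φ (1 ⊗ₜ x)).det ∈ Set.range (algebraMap K (SeparableClosure K)) := by
    rw [InfiniteGalois.mem_range_algebraMap_iff_fixed]
    intro σ
    -- The conjugate of `φ` by `σ`. The twists at source and target cancel on scalars, so it is
    -- another splitting over the separable closure, with the same determinants as `φ`.
    let f : (SeparableClosure K ⊗[K] B) ≃+* Matrix (Fin n) (Fin n) (SeparableClosure K) :=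
      ((Algebra.TensorProduct.congr (S := K) σ.symm
        (AlgEquiv.refl (R := K) (A₁ := B))).toRingEquiv.trans φ.toRingEquiv).trans
          σ.toRingEquiv.mapMatrix
    have hf (r : SeparableClosure K) : f (r ⊗ₜ[K] (1 : B)) =
        algebraMap (SeparableClosure K) (Matrix (Fin n) (Fin n) (SeparableClosure K)) r := by
      have : σ.symm r ⊗ₜ[K] (1 : B) = σ.symm r • (1 : SeparableClosure K ⊗[K] B) := by
        rw [Algebra.TensorProduct.one_def, TensorProduct.smul_tmul', smul_eq_mul, mul_one]
      simp only [f, RingEquiv.trans_apply, AlgEquiv.coe_ringEquiv,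
        Algebra.TensorProduct.congr_apply, Algebra.TensorProduct.map_tmul, map_one]
      ext i j
      simp [this, Matrix.algebraMap_matrix_apply, Matrix.one_apply, apply_ite σ]
    let φ' : (SeparableClosure K ⊗[K] B) ≃ₐ[SeparableClosure K]
      Matrix (Fin n) (Fin n) (SeparableClosure K) := AlgEquiv.ofRingEquiv (f := f) hf
    have h := det_algEquiv_apply (φ.symm.trans φ') (φ (1 ⊗ₜ x))
    have h2 : φ' (1 ⊗ₜ x) = (φ (1 ⊗ₜ x)).map σ := by
      change f (1 ⊗ₜ x) = _
      simp [f, RingEquiv.mapMatrix_apply]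
    rw [AlgEquiv.trans_apply, AlgEquiv.symm_apply_apply, h2] at h
    exact (AlgHom.map_det σ.toAlgHom _).trans h
  exact ⟨c, _, _, _, n, φ, hc.symm⟩

/-- The only property of `reducedNorm` used below; it holds for whichever value is chosen in the
definition. -/
theorem reducedNorm_pow {n : ℕ} (hn : n ^ 2 = Module.finrank K B) (x : B) :
    reducedNorm K x ^ n = Algebra.norm K x := by
  have h := exists_isReducedNorm K x
  rw [reducedNorm, dif_pos h]
  exact h.choose_spec.pow_eq_norm hn

end ReducedNormLemmas

/-! ### Determinants of endomorphisms preserving a lattice. -/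

section Lattice

variable {K : Type*} [Field K] {R : Type*} [CommRing R] [IsDomain R] [IsPrincipalIdealRing R]
  [Algebra R K] [IsFractionRing R K] {V : Type*} [AddCommGroup V] [Module R V] [Module K V]
  [IsScalarTower R K V]

theorem algebraMap_det_restrict (M : Submodule R V) [Submodule.IsLattice K M] (T : V →ₗ[K] V)
    (f : M →ₗ[R] M) (hf : ∀ x : M, (f x : V) = T x) :
    algebraMap R K (LinearMap.det f) = LinearMap.det T := by
  have : Module.IsTorsionFree R K := inferInstance
  let b := Module.Free.chooseBasis R M
  let bK := b.extendOfIsLattice K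
  have hrepr (x : M) (i) : bK.repr (x : V) i = algebraMap R K (b.repr x i) := by
    have h1 : (x : V) = ∑ j, algebraMap R K (b.repr x j) • bK j := by
      conv_lhs => rw [← b.sum_repr x]
      simp only [bK, Module.Basis.extendOfIsLattice_apply, Submodule.coe_sum, Submodule.coe_smul,
        algebraMap_smul]
    rw [h1, bK.repr_sum_self]
  classical
  rw [← LinearMap.det_toMatrix b, ← LinearMap.det_toMatrix bK, RingHom.map_det]
  congr 1
  ext i j
  rw [RingHom.mapMatrix_apply, Matrix.map_apply, LinearMap.toMatrix_apply, LinearMap.toMatrix_apply,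
    ← hrepr, hf, Module.Basis.extendOfIsLattice_apply]

end Lattice

theorem norm_eq_zero_iff_of_divisionRing (K : Type*) [Field K] (D : Type*) [DivisionRing D]
    [Algebra K D] [FiniteDimensional K D] {x : D} : Algebra.norm K x = 0 ↔ x = 0 := by
  constructor
  · intro h
    by_contra hx
    have : Algebra.norm K (x * x⁻¹) = 1 := by rw [mul_inv_cancel₀ hx, map_one]
    rw [map_mul, h, zero_mul] at this
    exact zero_ne_one this
  · rintro rfl
    have := Algebra.norm_algebraMap (S := D) (0 : K)
    rwa [map_zero, zero_pow Module.finrank_pos.ne'] at this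

theorem exists_smul_mem_integer (K : Type*) [Field K] [ValuativeRel K] (c : K) :
    ∃ r : 𝒪[K], r ≠ 0 ∧ valuation K (r * c) ≤ 1 := by
  obtain ⟨⟨x, y⟩, hxy⟩ := IsLocalization.surj (nonZeroDivisors 𝒪[K]) c
  refine ⟨y, nonZeroDivisors.coe_ne_zero y, ?_⟩
  rw [mul_comm]
  exact hxy ▸ x.2

/-! ### The norm valuation on a division algebra over a local field. -/

section LocalField

variable (K : Type u) [Field K] [ValuativeRel K] [TopologicalSpace K]
  [IsNonarchimedeanLocalField K]

theorem t2Space_of_isNonarchimedeanLocalField : T2Space K := by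
  refine IsTopologicalAddGroup.t2Space_of_zero_sep fun x hx ↦ ?_
  refine ⟨_, (IsValuativeTopology.hasBasis_nhds_zero' K).mem_of_mem (i := valuation K x) ?_, ?_⟩
  · simpa using hx
  · simp

theorem isOpen_valuation_lt_one : IsOpen {x : K | valuation K x < 1} := by
  have := Valuation.isOpen_ball (v := valuation K) 1
  simpa [Valuation.restrict_lt_one_iff] using this

theorem isCompact_primitive (ι : Type*) [Finite ι] :
    IsCompact {c : ι → K | (∀ i, valuation K (c i) ≤ 1) ∧ ∃ i, ¬ valuation K (c i) < 1} := by
  have h1 : IsCompact (Set.univ.pi fun _ : ι ↦ {x : K | valuation K x ≤ 1}) :=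
    isCompact_univ_pi fun _ ↦ IsNonarchimedeanLocalField.isCompact_closedBall K 1
  have h2 : IsClosed (⋃ i : ι, {c : ι → K | ¬ valuation K (c i) < 1}) :=
    isClosed_iUnion_of_finite fun i ↦ (isOpen_valuation_lt_one K).isClosed_compl.preimage
      (continuous_apply (A := fun _ : ι ↦ K) i)
  convert h1.inter_right h2 using 1
  ext c
  simp

variable {K}

theorem exists_le_valuation_of_isCompact {X : Type*} [TopologicalSpace X] {C : Set X}
    (hC : IsCompact C) {f : X → K} (hf : ContinuousOn f C) (h0 : ∀ x ∈ C, f x ≠ 0) :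
    ∃ γ : ValueGroupWithZero K, γ ≠ 0 ∧ ∀ x ∈ C, γ ≤ valuation K (f x) := by
  have := t2Space_of_isNonarchimedeanLocalField K
  have h1 : (f '' C)ᶜ ∈ nhds (0 : K) :=
    (hC.image_of_continuousOn hf).isClosed.isOpen_compl.mem_nhds fun ⟨x, hx, h⟩ ↦ h0 x hx h
  obtain ⟨γ, hγ, h⟩ := (IsValuativeTopology.hasBasis_nhds_zero' K).mem_iff.1 h1
  exact ⟨γ, hγ, fun x hx ↦ not_lt.1 fun hlt ↦ h hlt ⟨x, hx, rfl⟩⟩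

variable (K) (D : Type v) [DivisionRing D] [Algebra K D] [FiniteDimensional K D]

theorem continuous_norm_sum_smul {A ι : Type*} [Ring A] [Algebra K A] [Fintype ι]
    (b : Module.Basis ι K A) : Continuous fun c : ι → K ↦ Algebra.norm K (∑ i, c i • b i) := by
  classical
  simp_rw [Algebra.norm_eq_matrix_det b, map_sum, map_smul]
  refine Continuous.matrix_det ?_
  fun_prop

/-- The norm is continuous and nonvanishing on the compact set of primitive coordinate vectors,
hence bounded below there by some `γ`. Dividing `x` by its largest coordinate `a` makes it
primitive. -/
theorem exists_valuation_repr_le : ∃ δ : ValueGroupWithZero K, ∀ x : D,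
    valuation K (Algebra.norm K x) ≤ 1 → ∀ i,
      valuation K ((Module.finBasis K D).repr x i) ≤ δ := by
  let b := Module.finBasis K D
  obtain ⟨γ, hγ, h⟩ := exists_le_valuation_of_isCompact
    (isCompact_primitive K (Fin (Module.finrank K D)))
    (continuous_norm_sum_smul K b).continuousOn (by
      rintro c ⟨-, i, hi⟩ h0
      rw [norm_eq_zero_iff_of_divisionRing] at h0
      have := Fintype.linearIndependent_iff.1 b.linearIndependent c h0 i
      simp [this] at hi)
  refine ⟨max 1 γ⁻¹, fun x hx i ↦ ?_⟩
  obtain ⟨j, -, hj⟩ := Finset.exists_max_image Finset.univ (fun i ↦ valuation K (b.repr x i))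
    ⟨i, Finset.mem_univ i⟩
  refine (hj i (Finset.mem_univ i)).trans ?_
  set a := b.repr x j with ha
  -- Only `|a| > 1` needs an argument; then `|a| ≤ |a| ^ d ≤ γ⁻¹` with `d` the dimension of `D`.
  rw [le_max_iff, or_iff_not_imp_left, not_le]
  intro h1
  have ha0 : a ≠ 0 := by
    rintro h0
    simp [h0] at h1
  have hva : valuation K a ≠ 0 := by simpa using ha0
  have h2 := h (fun i ↦ a⁻¹ * b.repr x i) ⟨fun i ↦ by
    have := hj i (Finset.mem_univ i)
    rw [map_mul, map_inv₀]
    exact (mul_le_mul_right this _).trans (inv_mul_cancel₀ hva).le, j, by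
      simp [← ha, inv_mul_cancel₀ ha0]⟩
  have h3 : ∑ i, (a⁻¹ * b.repr x i) • b i = algebraMap K D a⁻¹ * x := by
    simp_rw [mul_smul, ← Finset.smul_sum, b.sum_repr, Algebra.smul_def]
  rw [h3, map_mul, Algebra.norm_algebraMap, map_mul, map_pow, map_inv₀, inv_pow] at h2
  have h4 : γ ≤ (valuation K a ^ Module.finrank K D)⁻¹ :=
    h2.trans (mul_le_of_le_one_right' hx)
  have h5 : valuation K a ^ Module.finrank K D ≤ γ⁻¹ :=
    (le_inv_comm₀ (zero_lt_iff.2 hγ) (pow_pos (zero_lt_iff.2 hva) _)).1 h4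
  exact (le_self_pow₀ h1.le Module.finrank_pos.ne').trans h5

/-- The `𝒪[K]`-span of the elements of integral norm. -/
def normSpan : Submodule 𝒪[K] D := Submodule.span 𝒪[K] {x | valuation K (Algebra.norm K x) ≤ 1}

theorem normSpan_fg : (normSpan K D).FG := by
  obtain ⟨δ, h⟩ := exists_valuation_repr_le K D
  obtain ⟨a, ha0, ha⟩ : ∃ a : K, a ≠ 0 ∧ δ ≤ valuation K a := by
    obtain ⟨a, rfl⟩ := ValuativeRel.valuation_surjective δ
    by_cases h0 : a = 0
    · exact ⟨1, one_ne_zero, by simp [h0]⟩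
    · exact ⟨a, h0, le_rfl⟩
  have hva : valuation K a ≠ 0 := by simpa using ha0
  let b := Module.finBasis K D
  refine Submodule.FG.of_le (Submodule.fg_span (Set.finite_range fun i ↦ a • b i)) ?_
  refine Submodule.span_le.2 fun x hx ↦ ?_
  rw [← b.sum_repr x]
  refine Submodule.sum_mem _ fun i _ ↦ ?_
  have h1 : valuation K (a⁻¹ * b.repr x i) ≤ 1 := by
    rw [map_mul, map_inv₀]
    exact (mul_le_mul_right ((h x hx i).trans ha) _).trans (inv_mul_cancel₀ hva).le
  have h2 : b.repr x i • b i = (⟨_, h1⟩ : 𝒪[K]) • (a • b i) := by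
    rw [Subring.smul_def, smul_smul, mul_right_comm, inv_mul_cancel₀ ha0, one_mul]
  rw [h2]
  exact Submodule.smul_mem _ _ (Submodule.subset_span ⟨i, rfl⟩)

instance normSpan_isLattice : Submodule.IsLattice K (normSpan K D) where
  fg := normSpan_fg K D
  span_eq_top := by
    rw [eq_top_iff]
    intro x _
    by_cases hx : x = 0
    · simp [hx]
    obtain ⟨r, hr, h⟩ := exists_smul_mem_integer K (Algebra.norm K x)
    have hr' : (r : K) ≠ 0 := by simpa using hr
    have hmem : (r : K) • x ∈ normSpan K D := by
      refine Submodule.subset_span ?_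
      rw [Set.mem_ofPred_eq, Algebra.smul_def, map_mul, Algebra.norm_algebraMap]
      obtain ⟨k, hk⟩ := Nat.exists_eq_succ_of_ne_zero (Module.finrank_pos (R := K) (M := D)).ne'
      rw [hk, pow_succ, mul_assoc, map_mul]
      refine mul_le_one' ?_ h
      rw [map_pow]
      exact pow_le_one' r.2 _
    rw [← inv_smul_smul₀ hr' x]
    exact Submodule.smul_mem _ _ (Submodule.subset_span hmem)

/-- An element stabilizing a lattice has integral norm. -/
theorem valuation_norm_le_one_of_stable {A : Type*} [Ring A] [Algebra K A] (M : Submodule 𝒪[K] A)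
    [Submodule.IsLattice K M] {x : A} (hx : ∀ y ∈ M, x * y ∈ M) :
    valuation K (Algebra.norm K x) ≤ 1 := by
  let f : M →ₗ[𝒪[K]] M := ((Algebra.lmul 𝒪[K] A x)).restrict hx
  have := algebraMap_det_restrict (K := K) M (Algebra.lmul K A x) f fun y ↦ rfl
  rw [Algebra.norm_apply, ← this]
  exact (LinearMap.det f).2

/-- The span is closed under multiplication because the norm is multiplicative, so its elements
stabilize a lattice. Hence elements of integral norm are closed under addition, which gives the
ultrametric inequality. -/
theorem mem_normSpan_iff {x : D} : x ∈ normSpan K D ↔ valuation K (Algebra.norm K x) ≤ 1 := by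
  refine ⟨fun hx ↦ valuation_norm_le_one_of_stable K (normSpan K D) fun y hy ↦ ?_,
    fun hx ↦ Submodule.subset_span hx⟩
  have := Submodule.mul_mem_mul hx hy
  rw [normSpan, Submodule.span_mul_span] at this
  refine Submodule.span_mono ?_ this
  rintro _ ⟨a, ha, b, hb, rfl⟩
  simp only [Set.mem_ofPred_eq, map_mul] at ha hb ⊢
  exact mul_le_one' ha hb

/-- The valuation of `K` composed with the norm. -/
def normValuation : Valuation D (ValueGroupWithZero K) where
  toFun x := valuation K (Algebra.norm K x)
  map_zero' := by rw [(norm_eq_zero_iff_of_divisionRing K D).2 rfl, map_zero]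
  map_one' := by simp
  map_mul' := by simp
  map_add_le_max' := by
    have key : ∀ x y : D, valuation K (Algebra.norm K x) ≤ valuation K (Algebra.norm K y) →
        valuation K (Algebra.norm K (x + y)) ≤ valuation K (Algebra.norm K y) := by
      intro x y h
      by_cases hy : y = 0
      · subst hy
        simpa using h
      have h1 : y⁻¹ * x ∈ normSpan K D := by
        rw [mem_normSpan_iff]
        have : valuation K (Algebra.norm K (y⁻¹ * y)) = 1 := by simp [inv_mul_cancel₀ hy]
        rw [map_mul, map_mul] at this ⊢
        exact (mul_le_mul_right h _).trans this.le
      have h2 : (1 : D) ∈ normSpan K D := by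
        rw [mem_normSpan_iff]
        simp
      have h3 := (mem_normSpan_iff K D).1 (add_mem h1 h2)
      have h4 : x + y = y * (y⁻¹ * x + 1) := by
        rw [mul_add, mul_inv_cancel_left₀ hy, mul_one]
      rw [h4, map_mul, map_mul]
      exact mul_le_of_le_one_right' h3
    intro x y
    rcases le_total (valuation K (Algebra.norm K x)) (valuation K (Algebra.norm K y)) with h | h
    · exact (key x y h).trans (le_max_right _ _)
    · rw [add_comm]
      exact (key y x h).trans (le_max_left _ _)

variable {D}

theorem normValuation_apply (x : D) : normValuation K D x = valuation K (Algebra.norm K x) := rfl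

theorem normValuation_algebraMap (c : K) :
    normValuation K D (algebraMap K D c) = valuation K c ^ Module.finrank K D := by
  rw [normValuation_apply, Algebra.norm_algebraMap, map_pow]

end LocalField

section Irreducible

variable {K : Type*} [Field K] [ValuativeRel K]

theorem valuation_irreducible_lt_one {ϖ : 𝒪[K]} (hϖ : Irreducible ϖ) :
    valuation K (ϖ : K) < 1 :=
  lt_of_le_of_ne ϖ.2 fun h ↦ hϖ.not_isUnit <|
    ((Valuation.integer.integers (valuation K)).isUnit_iff_valuation_eq_one).2 h

theorem valuation_irreducible_pos {ϖ : 𝒪[K]} (hϖ : Irreducible ϖ) :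
    0 < valuation K (ϖ : K) := by
  rw [zero_lt_iff, (valuation K).ne_zero_iff]
  simpa using hϖ.ne_zero

theorem valuation_irreducible_pow_le_iff {ϖ : 𝒪[K]} (hϖ : Irreducible ϖ) {i j : ℕ} :
    valuation K (ϖ : K) ^ i ≤ valuation K (ϖ : K) ^ j ↔ j ≤ i :=
  (pow_right_strictAnti₀ (valuation_irreducible_pos hϖ) (valuation_irreducible_lt_one hϖ)).le_iff_ge

theorem valuation_irreducible_pow_inj {ϖ : 𝒪[K]} (hϖ : Irreducible ϖ) {i j : ℕ}
    (h : valuation K (ϖ : K) ^ i = valuation K (ϖ : K) ^ j) : i = j :=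
  le_antisymm ((valuation_irreducible_pow_le_iff hϖ).1 h.ge)
    ((valuation_irreducible_pow_le_iff hϖ).1 h.le)

end Irreducible

/-! ### Uniformizers of a division algebra and the size of its residue ring. -/

section DivisionAlgebra

variable {K : Type u} [Field K] [ValuativeRel K] [TopologicalSpace K]
  [IsNonarchimedeanLocalField K]

theorem exists_valuation_eq_pow {ϖ : 𝒪[K]} (hϖ : Irreducible ϖ) {a : K} (ha : a ≠ 0)
    (h : valuation K a ≤ 1) : ∃ k : ℕ, valuation K a = valuation K (ϖ : K) ^ k := by
  obtain ⟨k, u, hu⟩ := IsDiscreteValuationRing.eq_unit_mul_pow_irreducible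
    (x := (⟨a, h⟩ : 𝒪[K])) (fun h0 ↦ ha (congrArg Subtype.val h0)) hϖ
  refine ⟨k, ?_⟩
  have h1 : valuation K ((u : 𝒪[K]) : K) = 1 :=
    ((Valuation.integer.integers (valuation K)).isUnit_iff_valuation_eq_one).1 u.isUnit
  have h2 : a = (u : 𝒪[K]) * (ϖ : K) ^ k := by simpa using congrArg Subtype.val hu
  rw [h2, map_mul, h1, one_mul, map_pow]

variable (K) (D : Type v) [DivisionRing D] [Algebra K D] [FiniteDimensional K D]

theorem exists_normValuation_uniformizer {ϖ : 𝒪[K]} (hϖ : Irreducible ϖ) :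
    ∃ (π : D) (f e : ℕ), 0 < f ∧ f * e = Module.finrank K D ∧
      normValuation K D π = valuation K (ϖ : K) ^ f ∧
      ∀ x, normValuation K D x < 1 → normValuation K D x ≤ normValuation K D π := by
  classical
  let w := normValuation K D
  have hwϖ : w (algebraMap K D ϖ) = valuation K (ϖ : K) ^ Module.finrank K D :=
    normValuation_algebraMap K _
  have hex : ∃ k, 0 < k ∧ ∃ x : D, w x = valuation K (ϖ : K) ^ k :=
    ⟨_, Module.finrank_pos, _, hwϖ⟩
  obtain ⟨hf, π, hπ⟩ := Nat.find_spec hex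
  set f := Nat.find hex
  have hmin : ∀ k, 0 < k → (∃ x : D, w x = valuation K (ϖ : K) ^ k) → f ≤ k :=
    fun k hk h ↦ Nat.find_min' hex ⟨hk, h⟩
  refine ⟨π, f, Module.finrank K D / f, hf, ?_, hπ, fun x hx ↦ ?_⟩
  · refine Nat.mul_div_cancel' (Nat.dvd_of_mod_eq_zero ?_)
    by_contra h
    -- Euclidean division: the witness has as exponent the remainder of the dimension modulo `f`,
    -- contradicting minimality of `f`.
    have h1 := hmin _ (Nat.pos_of_ne_zero h)
      ⟨algebraMap K D ϖ * (π ^ (Module.finrank K D / f))⁻¹, by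
        have h0 := (pow_pos (valuation_irreducible_pos hϖ)
          (f * (Module.finrank K D / f))).ne'
        rw [map_mul, hwϖ, map_inv₀, map_pow, hπ, ← pow_mul, mul_inv_eq_iff_eq_mul₀ h0, ← pow_add,
          Nat.mod_add_div]⟩
    exact absurd (Nat.mod_lt (Module.finrank K D) hf) (not_lt.2 h1)
  · by_cases hx0 : x = 0
    · simp [hx0]
    have hN : Algebra.norm K x ≠ 0 := by rwa [Ne, norm_eq_zero_iff_of_divisionRing]
    obtain ⟨k, hk⟩ := exists_valuation_eq_pow hϖ hN hx.le
    change w x ≤ w π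
    rw [hπ]
    change w x = _ at hk
    rw [hk, valuation_irreducible_pow_le_iff hϖ]
    refine hmin k (Nat.pos_of_ne_zero ?_) ⟨x, hk⟩
    rintro rfl
    rw [pow_zero] at hk
    exact hx.ne hk

/-- The elements of integral norm of a division algebra over a local field. -/
def divisionIntegers : Subalgebra 𝒪[K] D where
  __ := (normValuation K D).integer
  algebraMap_mem' r := by
    have : normValuation K D (algebraMap K D r) ≤ 1 := by
      rw [normValuation_algebraMap]
      exact pow_le_one' r.2 _
    exact this

variable {K D}

theorem mem_divisionIntegers {x : D} : x ∈ divisionIntegers K D ↔ normValuation K D x ≤ 1 :=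
  Iff.rfl

theorem map_mulLeft_leAddSubgroup {a : D} (ha : a ≠ 0) (γ : ValueGroupWithZero K) :
    ((normValuation K D).leAddSubgroup γ).map (AddMonoidHom.mulLeft a) =
      (normValuation K D).leAddSubgroup (normValuation K D a * γ) := by
  have hw : 0 < normValuation K D a := by simpa [zero_lt_iff] using ha
  ext x
  simp only [AddSubgroup.mem_map, Valuation.mem_leAddSubgroup_iff, AddMonoidHom.coe_mulLeft]
  constructor
  · rintro ⟨y, hy, rfl⟩
    rw [map_mul]
    exact mul_le_mul_right hy _
  · intro h
    refine ⟨a⁻¹ * x, ?_, mul_inv_cancel_left₀ ha x⟩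
    rw [map_mul, map_inv₀]
    exact (inv_mul_le_iff₀ hw).2 h

/-- Multiplication by `π ^ n` identifies each successive quotient of the filtration with the first
one. -/
theorem relIndex_leAddSubgroup_pow {π : D} (hπ0 : π ≠ 0) (hπ : normValuation K D π ≤ 1) (n : ℕ) :
    ((normValuation K D).leAddSubgroup (normValuation K D π ^ n)).relIndex
        ((normValuation K D).leAddSubgroup 1) =
      ((normValuation K D).leAddSubgroup (normValuation K D π)).relIndex
        ((normValuation K D).leAddSubgroup 1) ^ n := by
  induction n with
  | zero => simp
  | succ n ih =>
    have h1 := AddSubgroup.relIndex_map_map_of_injective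
      ((normValuation K D).leAddSubgroup (normValuation K D π))
      ((normValuation K D).leAddSubgroup 1) (f := AddMonoidHom.mulLeft (π ^ n))
      (mul_right_injective₀ (pow_ne_zero n hπ0))
    rw [map_mulLeft_leAddSubgroup (pow_ne_zero n hπ0), map_mulLeft_leAddSubgroup
      (pow_ne_zero n hπ0), map_pow, mul_one, ← pow_succ] at h1
    refine (AddSubgroup.relIndex_mul_relIndex _ ((normValuation K D).leAddSubgroup
      (normValuation K D π ^ n)) _ (fun x hx ↦ ?_) fun x hx ↦ ?_).symm.trans
        (by rw [h1, ih, pow_succ, mul_comm])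
    · rw [Valuation.mem_leAddSubgroup_iff] at hx ⊢
      exact hx.trans (pow_le_pow_right_of_le_one' hπ n.le_succ)
    · rw [Valuation.mem_leAddSubgroup_iff] at hx ⊢
      exact hx.trans (pow_le_one' hπ n)

/-- The integers of `D` are free over `𝒪[K]` of rank the dimension of `D`, and the subgroup is their
multiple by `ϖ`. Reducing coordinates counts the quotient. -/
theorem relIndex_leAddSubgroup_irreducible {ϖ : 𝒪[K]} (hϖ : Irreducible ϖ) :
    ((normValuation K D).leAddSubgroup (valuation K (ϖ : K) ^ Module.finrank K D)).relIndex
        ((normValuation K D).leAddSubgroup 1) = Nat.card 𝓀[K] ^ Module.finrank K D := by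
  let M := normSpan K D
  have hϖ0 : (ϖ : K) ≠ 0 := by simpa using hϖ.ne_zero
  let b := Module.Free.chooseBasis 𝒪[K] M
  let ι := Module.Free.ChooseBasisIndex 𝒪[K] M
  have hι : Nat.card ι = Module.finrank K D := by
    rw [Module.finrank_eq_nat_card_basis (b.extendOfIsLattice K)]
  have hM (x : D) : x ∈ M ↔ x ∈ (normValuation K D).leAddSubgroup 1 := mem_normSpan_iff K D
  let g : (normValuation K D).leAddSubgroup 1 →+ (ι → 𝓀[K]) :=
    { toFun x i := IsLocalRing.residue 𝒪[K] (b.repr ⟨x, (hM _).2 x.2⟩ i)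
      map_zero' := by
        funext i
        change IsLocalRing.residue 𝒪[K] (b.repr 0 i) = 0
        simp
      map_add' x y := by
        funext i
        change IsLocalRing.residue 𝒪[K]
          (b.repr (⟨x, (hM _).2 x.2⟩ + ⟨y, (hM _).2 y.2⟩) i) = _
        rw [map_add, Finsupp.add_apply, map_add]
        rfl }
  have hg : Function.Surjective g := by
    intro c
    choose r hr using fun i ↦ IsLocalRing.residue_surjective (c i)
    let m := b.equivFun.symm r
    refine ⟨⟨m, (hM _).1 m.2⟩, ?_⟩
    funext i
    simp only [g, AddMonoidHom.coe_mk, ZeroHom.coe_mk, Subtype.coe_eta]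
    rw [← hr i, ← b.equivFun_apply, LinearEquiv.apply_symm_apply]
  have hker : ((normValuation K D).leAddSubgroup
      (valuation K (ϖ : K) ^ Module.finrank K D)).addSubgroupOf
        ((normValuation K D).leAddSubgroup 1) = g.ker := by
    have hsmul (y : D) : normValuation K D ((ϖ : K) • y) =
        valuation K (ϖ : K) ^ Module.finrank K D * normValuation K D y := by
      rw [Algebra.smul_def, map_mul, normValuation_algebraMap]
    have hpos : 0 < valuation K (ϖ : K) ^ Module.finrank K D :=
      pow_pos (valuation_irreducible_pos hϖ) _
    ext ⟨x, hx⟩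
    rw [AddSubgroup.mem_addSubgroupOf, AddMonoidHom.mem_ker, Valuation.mem_leAddSubgroup_iff]
    constructor
    · intro h
      have hy : (ϖ : K)⁻¹ • x ∈ M := by
        rw [hM, Valuation.mem_leAddSubgroup_iff]
        change normValuation K D x ≤ _ at h
        rw [← smul_inv_smul₀ hϖ0 x, hsmul] at h
        exact le_of_mul_le_mul_left (h.trans (mul_one _).ge) hpos
      have hxy : (⟨x, (hM _).2 hx⟩ : M) = ϖ • ⟨_, hy⟩ := by
        ext
        exact (smul_inv_smul₀ hϖ0 x).symm
      funext i
      simp only [g, AddMonoidHom.coe_mk, ZeroHom.coe_mk, hxy, map_smul, Finsupp.smul_apply,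
        smul_eq_mul, map_mul, Pi.zero_apply]
      rw [(IsLocalRing.residue_eq_zero_iff _).2 ((IsLocalRing.mem_maximalIdeal _).2 hϖ.not_isUnit),
        zero_mul]
    · intro h
      have h1 (i) : ∃ r, b.repr ⟨x, (hM _).2 hx⟩ i = ϖ * r := by
        have := congrFun h i
        simp only [g, AddMonoidHom.coe_mk, ZeroHom.coe_mk, Pi.zero_apply] at this
        rw [IsLocalRing.residue_eq_zero_iff, hϖ.maximalIdeal_eq, Ideal.mem_span_singleton] at this
        exact this
      choose r hr using h1
      have h2 : (⟨x, (hM _).2 hx⟩ : M) = ϖ • b.equivFun.symm r := by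
        apply b.equivFun.injective
        funext i
        rw [map_smul, LinearEquiv.apply_symm_apply]
        simp [hr]
      have h3 : x = (ϖ : K) • ((b.equivFun.symm r : M) : D) := congrArg Subtype.val h2
      change normValuation K D x ≤ _
      rw [h3, hsmul]
      refine (mul_le_mul_right ?_ _).trans (mul_one _).le
      exact (hM _).1 (b.equivFun.symm r).2
  rw [AddSubgroup.relIndex, hker, AddSubgroup.index_ker, AddMonoidHom.range_eq_top.2 hg,
    ← hι]
  simp [Nat.card_fun]

/-- The values of `π ^ e` and `ϖ` agree, so both index computations apply to one subgroup: `|F| ^ e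
= (q ^ f) ^ e`, where `q` is the order of the residue field of `K`. -/
theorem card_residue {ϖ : 𝒪[K]} (hϖ : Irreducible ϖ) {π : D} {f e : ℕ} (hf : 0 < f)
    (hfe : f * e = Module.finrank K D) (hπ : normValuation K D π = valuation K (ϖ : K) ^ f)
    (hmax : ∀ x, normValuation K D x < 1 → normValuation K D x ≤ normValuation K D π)
    {F : Type*} [Ring F] (ρ : divisionIntegers K D →+* F) (hρ : Function.Surjective ρ)
    (hker : ∀ x, ρ x = 0 ↔ normValuation K D x < 1) : Nat.card F = Nat.card 𝓀[K] ^ f := by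
  have hπ1 : normValuation K D π < 1 := by
    rw [hπ]
    exact pow_lt_one₀ zero_le (valuation_irreducible_lt_one hϖ) hf.ne'
  have hπ0 : π ≠ 0 := by
    rintro rfl
    rw [map_zero] at hπ
    exact (pow_pos (valuation_irreducible_pos hϖ) f).ne hπ
  have h1 : Nat.card F = ((normValuation K D).leAddSubgroup (normValuation K D π)).relIndex
      ((normValuation K D).leAddSubgroup 1) := by
    let g : (normValuation K D).leAddSubgroup 1 →+ F :=
      { toFun x := ρ ⟨x, x.2⟩
        map_zero' := map_zero ρ
        map_add' x y := map_add ρ ⟨x, x.2⟩ ⟨y, y.2⟩ }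
    have hg : Function.Surjective g := fun y ↦ by
      obtain ⟨x, rfl⟩ := hρ y
      exact ⟨⟨x, x.2⟩, rfl⟩
    have : ((normValuation K D).leAddSubgroup (normValuation K D π)).addSubgroupOf
        ((normValuation K D).leAddSubgroup 1) = g.ker := by
      ext ⟨x, hx⟩
      rw [AddSubgroup.mem_addSubgroupOf, AddMonoidHom.mem_ker, Valuation.mem_leAddSubgroup_iff]
      change _ ↔ ρ ⟨x, hx⟩ = 0
      rw [hker]
      exact ⟨fun h ↦ h.trans_lt hπ1, hmax x⟩
    rw [AddSubgroup.relIndex, this, AddSubgroup.index_ker, AddMonoidHom.range_eq_top.2 hg]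
    simp
  have he : e ≠ 0 := by
    rintro rfl
    exact Module.finrank_pos.ne hfe
  refine Nat.pow_left_injective he ?_
  change _ ^ e = (_ ^ f) ^ e
  rw [h1, ← relIndex_leAddSubgroup_pow hπ0 hπ1.le, hπ, ← pow_mul, ← pow_mul, hfe,
    relIndex_leAddSubgroup_irreducible hϖ]

end DivisionAlgebra

/-! ### The residue field of a division algebra and the bound on its degree. -/

section ResidueField

variable (K : Type u) [Field K] [ValuativeRel K] [TopologicalSpace K]
  [IsNonarchimedeanLocalField K]
  (D : Type v) [DivisionRing D] [Algebra K D] [FiniteDimensional K D]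

/-- The elements of norm in the maximal ideal. -/
def divisionMaximalIdeal : Ideal (divisionIntegers K D) where
  carrier := {x | normValuation K D x < 1}
  zero_mem' := by simp
  add_mem' {x y} hx hy := (normValuation K D).map_add_lt hx hy
  smul_mem' c x hx := by
    have : normValuation K D (c * x) < 1 := by
      rw [map_mul]
      exact mul_lt_one_of_nonneg_of_lt_one_right c.2 zero_le hx
    exact this

variable {K D}

theorem mem_divisionMaximalIdeal {x : divisionIntegers K D} :
    x ∈ divisionMaximalIdeal K D ↔ normValuation K D x < 1 := Iff.rfl

instance : (divisionMaximalIdeal K D).IsTwoSided where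
  mul_mem_of_left {x} c hx := by
    rw [mem_divisionMaximalIdeal] at hx ⊢
    have : normValuation K D (x * c) < 1 := by
      rw [map_mul]
      exact mul_lt_one_of_nonneg_of_lt_one_left zero_le hx c.2
    exact this

theorem normValuation_algebraMap_lt_one {r : 𝒪[K]} (hr : r ∈ 𝓂[K]) :
    normValuation K D (algebraMap K D r) < 1 := by
  rw [normValuation_algebraMap]
  refine pow_lt_one₀ zero_le ?_ Module.finrank_pos.ne'
  refine lt_of_le_of_ne r.2 fun h ↦ (IsLocalRing.mem_maximalIdeal _).1 hr ?_
  exact ((Valuation.integer.integers (valuation K)).isUnit_iff_valuation_eq_one).2 h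

variable (K D) in
-- Finiteness, supplied later by `card_residue`, is what makes the residue division ring
-- commutative.
theorem exists_residueField_of_finite
    (h : ∀ (F : Type v) [Ring F] (ρ : divisionIntegers K D →+* F), Function.Surjective ρ →
      (∀ x, ρ x = 0 ↔ normValuation K D x < 1) → Finite F) :
    ∃ (F : Type v) (_ : Field F) (_ : Finite F) (_ : Algebra 𝓀[K] F)
      (ρ : divisionIntegers K D →+* F), Function.Surjective ρ ∧
      (∀ x, ρ x = 0 ↔ normValuation K D x < 1) ∧
      ∀ r : 𝒪[K], ρ (algebraMap 𝒪[K] _ r) = algebraMap 𝓀[K] F (IsLocalRing.residue 𝒪[K] r) := by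
  let F := divisionIntegers K D ⧸ divisionMaximalIdeal K D
  let ρ : divisionIntegers K D →+* F := Ideal.Quotient.mk _
  have hρ : Function.Surjective ρ := Ideal.Quotient.mk_surjective
  have hker : ∀ x, ρ x = 0 ↔ normValuation K D x < 1 := fun x ↦ Ideal.Quotient.eq_zero_iff_mem
  have hfin : Finite F := h F ρ hρ hker
  have hnt : Nontrivial F := by
    refine ⟨⟨ρ 1, 0, fun h1 ↦ ?_⟩⟩
    have := (hker 1).1 h1
    simp at this
  have hunit : ∀ a : F, IsUnit a ∨ a = 0 := by
    intro a
    obtain ⟨x, rfl⟩ := hρ a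
    rw [or_iff_not_imp_right, hker, not_lt]
    intro hx
    have hx1 : normValuation K D x = 1 := le_antisymm x.2 hx
    have hx0 : (x : D) ≠ 0 := by
      intro h0
      rw [h0, map_zero] at hx1
      exact zero_ne_one hx1
    let y : divisionIntegers K D := ⟨(x : D)⁻¹, by
      rw [mem_divisionIntegers, map_inv₀, hx1, inv_one]⟩
    have h1 : x * y = 1 := Subtype.ext (mul_inv_cancel₀ hx0)
    have h2 : y * x = 1 := Subtype.ext (inv_mul_cancel₀ hx0)
    exact ⟨⟨ρ x, ρ y, by rw [← map_mul, h1, map_one], by rw [← map_mul, h2, map_one]⟩, rfl⟩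
  have hle : ∀ r ∈ 𝓂[K], ρ.comp (algebraMap 𝒪[K] _) r = 0 := by
    intro r hr
    rw [RingHom.comp_apply]
    refine (hker _).2 ?_
    exact normValuation_algebraMap_lt_one hr
  let : DivisionRing F := DivisionRing.ofIsUnitOrEqZero hunit
  let : Field F := littleWedderburn F
  let : Algebra 𝓀[K] F := (Ideal.Quotient.lift 𝓂[K] (ρ.comp (algebraMap 𝒪[K] _)) hle).toAlgebra
  exact ⟨F, inferInstance, hfin, inferInstance, ρ, hρ, hker, fun r ↦ rfl⟩

/-- Lift a primitive element and divide its relation of degree `n` by the coefficient of largest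
valuation. The relation becomes integral with a coefficient `1`, so it reduces to a nonzero
polynomial of degree at most `n`. -/
theorem finrank_residueField_le {n : ℕ}
    (hn : ∀ x : D, ∃ c : ℕ → K, c n = 1 ∧ ∑ i ∈ Finset.range (n + 1), c i • x ^ i = 0)
    {F : Type*} [Field F] [Finite F] [Algebra 𝓀[K] F] (ρ : divisionIntegers K D →+* F)
    (hρ : Function.Surjective ρ)
    (hcompat : ∀ r : 𝒪[K], ρ (algebraMap 𝒪[K] _ r) =
      algebraMap 𝓀[K] F (IsLocalRing.residue 𝒪[K] r)) : Module.finrank 𝓀[K] F ≤ n := by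
  have : Module.Finite 𝓀[K] F := Module.Finite.of_finite
  obtain ⟨α, hα⟩ := Field.exists_primitive_element 𝓀[K] F
  rw [Field.primitive_element_iff_minpoly_natDegree_eq] at hα
  rw [← hα]
  obtain ⟨a, rfl⟩ := hρ α
  obtain ⟨c, hcn, hc⟩ := hn a
  obtain ⟨j, hj, hmax⟩ := Finset.exists_max_image (Finset.range (n + 1))
    (fun i ↦ valuation K (c i)) ⟨n, by simp⟩
  have hcj : valuation K (c j) ≠ 0 := by
    have := hmax n (by simp)
    rw [hcn, map_one] at this
    exact (zero_lt_one.trans_le this).ne'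
  have hcj' : c j ≠ 0 := by simpa using hcj
  have hint : ∀ i, i ∈ Finset.range (n + 1) → valuation K ((c j)⁻¹ * c i) ≤ 1 := by
    intro i hi
    rw [map_mul, map_inv₀]
    exact (mul_le_mul_right (hmax i hi) _).trans (inv_mul_cancel₀ hcj).le
  classical
  let r : ℕ → 𝒪[K] := fun i ↦ if hi : i ∈ Finset.range (n + 1) then ⟨_, hint i hi⟩ else 0
  have hr : ∀ i ∈ Finset.range (n + 1), (r i : K) = (c j)⁻¹ * c i := fun i hi ↦ by
    simp only [r, dif_pos hi]
  have hrj : r j = 1 := by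
    ext
    rw [hr j hj, inv_mul_cancel₀ hcj']
    rfl
  have hsum : ∑ i ∈ Finset.range (n + 1), algebraMap 𝒪[K] (divisionIntegers K D) (r i) * a ^ i =
      0 := by
    ext
    have h1 : ∀ i ∈ Finset.range (n + 1),
        ((algebraMap 𝒪[K] (divisionIntegers K D) (r i) * a ^ i : divisionIntegers K D) : D) =
          (c j)⁻¹ • c i • (a : D) ^ i := by
      intro i hi
      rw [smul_smul, ← hr i hi, Algebra.smul_def]
      rfl
    rw [AddSubmonoidClass.coe_finsetSum, Finset.sum_congr rfl h1, ← Finset.smul_sum, hc, smul_zero]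
    rfl
  let p : Polynomial 𝓀[K] := ∑ i ∈ Finset.range (n + 1),
    Polynomial.monomial i (IsLocalRing.residue 𝒪[K] (r i))
  have hp : Polynomial.aeval (ρ a) p = 0 := by
    have := congrArg ρ hsum
    simpa [p, hcompat, Polynomial.aeval_monomial] using this
  have hp0 : p ≠ 0 := by
    intro h
    have := congrArg (fun q ↦ Polynomial.coeff q j) h
    simp only [p, Polynomial.finsetSum_coeff, Polynomial.coeff_monomial, Polynomial.coeff_zero,
      Finset.sum_ite_eq', if_pos hj, hrj, map_one] at this
    exact one_ne_zero this
  refine (Polynomial.natDegree_le_natDegree (minpoly.degree_le_of_ne_zero _ _ hp0 hp)).trans ?_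
  refine Polynomial.natDegree_sum_le_of_forall_le _ _ fun i hi ↦ ?_
  exact (Polynomial.natDegree_monomial_le _).trans (Nat.lt_succ_iff.1 (Finset.mem_range.1 hi))

variable (K D) in
/-- The valuation of a uniformizer of a central division algebra is at most its index. -/
theorem exists_uniformizer_residueField [Algebra.IsCentral K D] {ϖ : 𝒪[K]} (hϖ : Irreducible ϖ) :
    ∃ (π : D) (n f : ℕ), n ^ 2 = Module.finrank K D ∧ 0 < f ∧ f ≤ n ∧
      normValuation K D π = valuation K (ϖ : K) ^ f ∧
      (∀ x, normValuation K D x < 1 → normValuation K D x ≤ normValuation K D π) ∧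
      ∃ (F : Type v) (_ : Field F) (_ : Finite F) (_ : Algebra 𝓀[K] F)
        (ρ : divisionIntegers K D →+* F), Function.Surjective ρ ∧
        (∀ x, ρ x = 0 ↔ normValuation K D x < 1) ∧
        ∀ r : 𝒪[K], ρ (algebraMap 𝒪[K] _ r) =
          algebraMap 𝓀[K] F (IsLocalRing.residue 𝒪[K] r) := by
  obtain ⟨π, f, e, hf, hfe, hπ, hmax⟩ := exists_normValuation_uniformizer K D hϖ
  obtain ⟨n, -, ⟨φ⟩⟩ := exists_splitting K D
  have hcard {F : Type v} [Ring F] (ρ : divisionIntegers K D →+* F) (hρ : Function.Surjective ρ)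
      (hker : ∀ x, ρ x = 0 ↔ normValuation K D x < 1) : Nat.card F = Nat.card 𝓀[K] ^ f :=
    card_residue hϖ hf hfe hπ hmax ρ hρ hker
  obtain ⟨F, _, _, _, ρ, hρ, hker, hcompat⟩ :=
    exists_residueField_of_finite K D fun F _ ρ hρ hker ↦ by
      refine Nat.finite_of_card_ne_zero ?_
      rw [hcard ρ hρ hker]
      exact pow_ne_zero _ Nat.card_pos.ne'
  refine ⟨π, n, f, sq_eq_finrank_of_splitting φ, hf, ?_, hπ, hmax, F, _, ‹_›, _, ρ, hρ, hker,
    hcompat⟩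
  -- Since `F` has `q ^ f` elements, `q` being the order of `𝓀[K]`, its degree is `f`; the bound on
  -- the degree becomes `f ≤ n`.
  have h1 := finrank_residueField_le (exists_sum_pow_eq_zero_of_splitting φ) ρ hρ hcompat
  have : Module.Finite 𝓀[K] F := Module.Finite.of_finite
  have h2 := Module.natCard_eq_pow_finrank (K := 𝓀[K]) (V := F)
  rw [hcard ρ hρ hker] at h2
  rwa [Nat.pow_right_injective Finite.one_lt_card h2]

end ResidueField

/-! ### Maximal orders are integral matrix rings. -/

section MaximalOrder

variable {K : Type u} [Field K] [ValuativeRel K] [TopologicalSpace K]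
  [IsNonarchimedeanLocalField K]
  {D : Type v} [DivisionRing D] [Algebra K D] [FiniteDimensional K D]

/-- Finitely generated modules over the valuation ring of `D` in a `D`-vector space are free. -/
theorem exists_basis_span_eq {V : Type*} [AddCommGroup V] [Module D V]
    (Λ : Submodule (divisionIntegers K D) V) (hfg : Λ.FG)
    (hspan : Submodule.span D (Λ : Set V) = ⊤) :
    ∃ (s : Finset V) (b : Module.Basis s D V),
      Λ = Submodule.span (divisionIntegers K D) (Set.range b) := by
  classical
  have hex : ∃ n, ∃ s : Finset V, s.card = n ∧ Submodule.span (divisionIntegers K D) s = Λ :=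
    let ⟨s, hs⟩ := hfg
    ⟨_, s, rfl, hs⟩
  obtain ⟨s, hcard, hs⟩ := Nat.find_spec hex
  -- A generating set of minimal size is independent: in a relation, the vector whose coefficient
  -- has largest valuation is an integral combination of the others.
  have hli : LinearIndepOn D id (s : Set V) := by
    rw [linearIndepOn_finset_iff]
    by_contra! h
    obtain ⟨g, hg, i, hi, hgi⟩ := h
    obtain ⟨j, hj, hmax⟩ := s.exists_max_image (fun i ↦ normValuation K D (g i)) ⟨i, hi⟩
    have hpos : 0 < normValuation K D (g j) :=
      (zero_lt_iff.2 ((normValuation K D).ne_zero_iff.2 hgi)).trans_le (hmax i hi)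
    have hgj : g j ≠ 0 := (normValuation K D).ne_zero_iff.1 hpos.ne'
    have hmem : j ∈ Submodule.span (divisionIntegers K D) (s.erase j : Set V) := by
      have h1 : j = -∑ i ∈ s.erase j, ((g j)⁻¹ * g i) • i := by
        rw [← Finset.add_sum_erase s _ hj] at hg
        have h2 := congrArg ((g j)⁻¹ • ·) hg
        simp only [smul_add, smul_zero, id, inv_smul_smul₀ hgj, Finset.smul_sum, smul_smul] at h2
        exact eq_neg_of_add_eq_zero_left h2
      refine (congrArg (· ∈ Submodule.span (divisionIntegers K D) (s.erase j : Set V)) h1).mpr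
        (neg_mem (Submodule.sum_mem _ fun i hi ↦ ?_))
      have h3 : normValuation K D ((g j)⁻¹ * g i) ≤ 1 := by
        rw [map_mul, map_inv₀]
        exact (mul_le_mul_right (hmax i (Finset.mem_of_mem_erase hi)) _).trans
          (inv_mul_cancel₀ hpos.ne').le
      exact Submodule.smul_mem _ (⟨_, h3⟩ : divisionIntegers K D) (Submodule.subset_span hi)
    refine Nat.find_min hex (m := (s.erase j).card) ?_ ⟨s.erase j, rfl, ?_⟩
    · rw [← hcard]
      exact Finset.card_erase_lt_of_mem hj
    · rw [← hs]
      refine le_antisymm (Submodule.span_mono (Finset.coe_subset.2 (s.erase_subset j))) ?_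
      refine Submodule.span_le.2 fun x hx ↦ ?_
      by_cases hxj : x = j
      · exact hxj ▸ hmem
      · exact Submodule.subset_span (Finset.mem_coe.2 (Finset.mem_erase.2 ⟨hxj, hx⟩))
  have hsp : ⊤ ≤ Submodule.span D (Set.range fun x : s ↦ (x : V)) := by
    rw [← hspan, ← hs]
    refine Submodule.span_le.2 fun x hx ↦ ?_
    have := Submodule.span_le_restrictScalars (divisionIntegers K D) D (s : Set V) hx
    simpa using this
  have hli' : LinearIndependent D fun x : s ↦ (x : V) := hli
  refine ⟨s, Module.Basis.mk hli' hsp, ?_⟩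
  rw [Module.Basis.coe_mk, ← hs]
  simp

variable (K) in
theorem fg_integral_matrices (m : ℕ) :
    ∃ N : Submodule 𝒪[K] (Matrix (Fin m) (Fin m) D), N.FG ∧
      ∀ M, M ∈ N ↔ ∀ i j, normValuation K D (M i j) ≤ 1 := by
  let l : (Fin m → Fin m → normSpan K D) →ₗ[𝒪[K]] Matrix (Fin m) (Fin m) D :=
    { toFun f := Matrix.of fun i j ↦ (f i j : D)
      map_add' _ _ := rfl
      map_smul' _ _ := rfl }
  refine ⟨LinearMap.range l, ?_, fun M ↦ ⟨?_, fun h ↦ ?_⟩⟩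
  · rw [LinearMap.range_eq_map]
    exact Module.Finite.fg_top.map l
  · rintro ⟨f, rfl⟩ i j
    exact (mem_normSpan_iff K D).1 (f i j).2
  · exact ⟨fun i j ↦ ⟨M i j, (mem_normSpan_iff K D).2 (h i j)⟩, rfl⟩

variable {B : Type v} [Ring B] [Algebra K B]

/-- The elements of `B` that correspond to matrices with integral entries. -/
def integralMatrixOrder {m : ℕ} (e : B ≃ₐ[K] Matrix (Fin m) (Fin m) D) : Subalgebra 𝒪[K] B where
  carrier := {x | ∀ i j, normValuation K D (e x i j) ≤ 1}
  mul_mem' {x y} hx hy i j := by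
    rw [map_mul, Matrix.mul_apply]
    refine (normValuation K D).map_sum_le fun k _ ↦ ?_
    rw [map_mul]
    exact mul_le_one' (hx i k) (hy k j)
  add_mem' {x y} hx hy i j := by
    rw [map_add, Matrix.add_apply]
    exact (normValuation K D).map_add_le (hx i j) (hy i j)
  algebraMap_mem' r i j := by
    have : e (algebraMap 𝒪[K] B r) = algebraMap K _ (r : K) := e.commutes _
    rw [this, Matrix.algebraMap_matrix_apply]
    split_ifs
    · rw [normValuation_algebraMap]
      exact pow_le_one' r.2 _
    · simp

theorem mem_integralMatrixOrder {m : ℕ} {e : B ≃ₐ[K] Matrix (Fin m) (Fin m) D} {x : B} :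
    x ∈ integralMatrixOrder e ↔ ∀ i j, normValuation K D (e x i j) ≤ 1 := Iff.rfl

theorem integralMatrixOrder_fg {m : ℕ} (e : B ≃ₐ[K] Matrix (Fin m) (Fin m) D) :
    (Subalgebra.toSubmodule (integralMatrixOrder e)).FG := by
  obtain ⟨N, hN, hmem⟩ := fg_integral_matrices K (D := D) m
  have : Subalgebra.toSubmodule (integralMatrixOrder e) =
      N.map ((e.symm.toLinearEquiv : Matrix (Fin m) (Fin m) D →ₗ[K] B).restrictScalars 𝒪[K]) := by
    ext x
    rw [Subalgebra.mem_toSubmodule, mem_integralMatrixOrder, ← hmem, Submodule.mem_map]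
    exact ⟨fun h ↦ ⟨e x, h, e.symm_apply_apply x⟩, by
      rintro ⟨y, hy, rfl⟩
      convert hy
      exact e.apply_symm_apply y⟩
  rw [this]
  exact hN.map _

/-- The lattice spanned by the rows of the elements of an order. -/
def rowLattice {m : ℕ} (e : B ≃ₐ[K] Matrix (Fin m) (Fin m) D) (O : Subalgebra 𝒪[K] B) :
    Submodule (divisionIntegers K D) (Fin m → D) :=
  Submodule.span _ {v | ∃ x ∈ O, ∃ i, e x i = v}

theorem vecMul_mem_rowLattice {m : ℕ} (e : B ≃ₐ[K] Matrix (Fin m) (Fin m) D)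
    (O : Subalgebra 𝒪[K] B) {v : Fin m → D} (hv : v ∈ rowLattice e O) {x : B} (hx : x ∈ O) :
    v ᵥ* e x ∈ rowLattice e O := by
  induction hv using Submodule.span_induction with
  | mem v hv =>
    obtain ⟨y, hy, i, rfl⟩ := hv
    refine Submodule.subset_span ⟨y * x, mul_mem hy hx, i, ?_⟩
    rw [map_mul]
    rfl
  | zero => simp
  | add v w _ _ hv hw =>
    rw [Matrix.add_vecMul]
    exact add_mem hv hw
  | smul d v _ hv =>
    have : (d • v) ᵥ* e x = d • (v ᵥ* e x) := Matrix.smul_vecMul (d : D) v (e x)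
    rw [this]
    exact Submodule.smul_mem _ _ hv

theorem single_mem_rowLattice {m : ℕ} (e : B ≃ₐ[K] Matrix (Fin m) (Fin m) D)
    (O : Subalgebra 𝒪[K] B) (i : Fin m) : Pi.single i 1 ∈ rowLattice e O := by
  refine Submodule.subset_span ⟨1, one_mem O, i, ?_⟩
  rw [map_one]
  ext j
  simp [Matrix.one_apply, Pi.single_apply, eq_comm]

theorem rowLattice_fg {m : ℕ} (e : B ≃ₐ[K] Matrix (Fin m) (Fin m) D) {O : Subalgebra 𝒪[K] B}
    (hO : (Subalgebra.toSubmodule O).FG) : (rowLattice e O).FG := by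
  obtain ⟨t, ht⟩ := hO
  have hfin : {v | ∃ x ∈ t, ∃ i, e x i = v}.Finite := by
    have : {v | ∃ x ∈ t, ∃ i, e x i = v} = ⋃ x ∈ t, Set.range (e x) := by
      ext v
      simp only [Set.mem_iUnion, exists_prop]
      rfl
    rw [this]
    exact t.finite_toSet.biUnion fun x _ ↦ Set.finite_range _
  have : rowLattice e O = Submodule.span _ {v | ∃ x ∈ t, ∃ i, e x i = v} := by
    refine le_antisymm (Submodule.span_le.2 ?_) (Submodule.span_mono ?_)
    · rintro _ ⟨x, hx, i, rfl⟩
      rw [← Subalgebra.mem_toSubmodule, ← ht] at hx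
      induction hx using Submodule.span_induction with
      | mem x hx => exact Submodule.subset_span ⟨x, hx, i, rfl⟩
      | zero =>
        rw [map_zero]
        exact zero_mem _
      | add x y _ _ hx hy =>
        rw [map_add]
        exact add_mem hx hy
      | smul r x _ hx =>
        have h1 : e (r • x) i = (algebraMap 𝒪[K] (divisionIntegers K D) r) • e x i := by
          have : e (r • x) = (r : K) • e x := map_smul e (r : K) x
          rw [this]
          ext j
          exact Algebra.smul_def _ _
        rw [h1]
        exact Submodule.smul_mem _ _ hx
    · rintro v ⟨x, hx, i, rfl⟩
      refine ⟨x, ?_, i, rfl⟩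
      rw [← Subalgebra.mem_toSubmodule, ← ht]
      exact Submodule.subset_span hx
  rw [this]
  exact Submodule.fg_span hfin

/-- Every order is contained in a conjugate of the order of integral matrices. -/
theorem exists_le_integralMatrixOrder {m : ℕ} (e : B ≃ₐ[K] Matrix (Fin m) (Fin m) D)
    {O : Subalgebra 𝒪[K] B} (hO : (Subalgebra.toSubmodule O).FG) :
    ∃ e' : B ≃ₐ[K] Matrix (Fin m) (Fin m) D, O ≤ integralMatrixOrder e' := by
  have hspan : Submodule.span D (rowLattice e O : Set (Fin m → D)) = ⊤ := by
    rw [eq_top_iff, ← (Pi.basisFun D (Fin m)).span_eq]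
    refine Submodule.span_mono ?_
    rintro _ ⟨i, rfl⟩
    rw [Pi.basisFun_apply]
    exact single_mem_rowLattice e O i
  obtain ⟨s, b₀, hb₀⟩ := exists_basis_span_eq _ (rowLattice_fg e hO) hspan
  have hcard : Fintype.card s = Fintype.card (Fin m) := by
    rw [← Module.finrank_eq_card_basis b₀, Module.finrank_fin_fun, Fintype.card_fin]
  let b := b₀.reindex (Fintype.equivOfCardEq hcard)
  have hb : rowLattice e O = Submodule.span (divisionIntegers K D) (Set.range b) := by
    rw [hb₀, Module.Basis.range_reindex]
  have hrepr : ∀ v ∈ rowLattice e O, ∀ i, normValuation K D (b.repr v i) ≤ 1 := by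
    intro v hv i
    rw [hb] at hv
    induction hv using Submodule.span_induction with
    | mem v hv =>
      obtain ⟨j, rfl⟩ := hv
      rw [b.repr_self, Finsupp.single_apply]
      split_ifs <;> simp
    | zero => simp
    | add v w _ _ hv hw =>
      rw [map_add, Finsupp.add_apply]
      exact (normValuation K D).map_add_le hv hw
    | smul d v _ hv =>
      have : b.repr (d • v) i = d * b.repr v i := by
        have : b.repr (d • v) = (d : D) • b.repr v := map_smul b.repr (d : D) v
        rw [this]
        rfl
      rw [this, map_mul]
      exact mul_le_one' d.2 hv
  -- The rows of `g` are the basis `b` of the stable row lattice, so row `i` of `g * e x * g⁻¹`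
  -- lists the coordinates of `b i ᵥ* e x` in `b`, which are integral.
  let g : Matrix (Fin m) (Fin m) D := Matrix.of b
  let g' : Matrix (Fin m) (Fin m) D := Matrix.of fun i j ↦ b.repr (Pi.single i 1) j
  have hvec (v : Fin m → D) : v ᵥ* g' = b.repr v := by
    ext j
    conv_rhs => rw [← (Pi.basisFun D (Fin m)).sum_repr v]
    simp [Matrix.vecMul, dotProduct, g', map_sum]
  have h1 : g * g' = 1 := by
    ext i j
    have : (g * g') i = b i ᵥ* g' := rfl
    rw [this, hvec, b.repr_self, Matrix.one_apply, Finsupp.single_apply]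
  have h2 : g' * g = 1 := by
    ext i j
    have : (g' * g) i = ∑ k, g' i k • b k := by
      ext j
      simp [Matrix.mul_apply, g]
    rw [this]
    have := b.sum_repr (Pi.single i 1)
    change (∑ k, b.repr (Pi.single i 1) k • b k) j = _
    rw [this, Matrix.one_apply, Pi.single_apply]
    simp [eq_comm]
  let u : (Matrix (Fin m) (Fin m) D)ˣ := ⟨g, g', h1, h2⟩
  refine ⟨e.trans (MulSemiringAction.toAlgEquiv K _ (ConjAct.toConjAct u)), fun x hx ↦ ?_⟩
  rw [mem_integralMatrixOrder]
  intro i j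
  have h3 : e.trans (MulSemiringAction.toAlgEquiv K _ (ConjAct.toConjAct u)) x = g * e x * g' := rfl
  have h4 : (g * e x * g') i = (b i ᵥ* e x) ᵥ* g' := rfl
  rw [h3, h4, hvec]
  refine hrepr _ (vecMul_mem_rowLattice e O ?_ hx) j
  rw [hb]
  exact Submodule.subset_span ⟨i, rfl⟩

theorem IsMaximalOrder.exists_eq_integralMatrixOrder {m : ℕ}
    (e : B ≃ₐ[K] Matrix (Fin m) (Fin m) D) {O : Subalgebra 𝒪[K] B} (hO : IsMaximalOrder K O) :
    ∃ e' : B ≃ₐ[K] Matrix (Fin m) (Fin m) D, O = integralMatrixOrder e' := by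
  obtain ⟨e', he'⟩ := exists_le_integralMatrixOrder e hO.prop.1
  refine ⟨e', le_antisymm he' (hO.le_of_ge ⟨integralMatrixOrder_fg e', ?_⟩ he')⟩
  rw [eq_top_iff, ← hO.prop.2]
  exact Submodule.span_mono he'

end MaximalOrder

/-! ### Maximal left ideals and lines. -/

section LineIdeal

variable {F : Type w} [Field F] {m : ℕ}

theorem exists_idempotent_ker_eq (W : Submodule F (Fin m → F)) :
    ∃ T : Matrix (Fin m) (Fin m) F, T * T = T ∧ LinearMap.ker T.mulVecLin = W := by
  obtain ⟨W', hW⟩ := W.exists_isCompl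
  let p := W'.projection W hW.symm
  refine ⟨LinearMap.toMatrix' p, ?_, ?_⟩
  · rw [← LinearMap.toMatrix'_mul]
    congr 1
    exact Submodule.isIdempotentElem_projection hW.symm
  · rw [← Matrix.toLin'_apply', Matrix.toLin'_toMatrix']
    exact Submodule.ker_projection hW.symm

theorem exists_mulVec_eq {x : Fin m → F} (hx : x ≠ 0) (y : Fin m → F) :
    ∃ C : Matrix (Fin m) (Fin m) F, C *ᵥ x = y := by
  obtain ⟨f, hf⟩ := Module.Projective.exists_dual_eq_one F hx
  refine ⟨LinearMap.toMatrix' (f.smulRight y), ?_⟩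
  rw [← Matrix.toLin'_apply, Matrix.toLin'_toMatrix']
  simp [hf]

/-- A left ideal contains every rank-one matrix whose row lies in its row space. A proper ideal thus
has a proper row space, and a functional vanishing on that space is the vector sought. -/
theorem exists_mulVec_eq_zero_of_ne_top {I : Ideal (Matrix (Fin m) (Fin m) F)} (hI : I ≠ ⊤) :
    ∃ x : Fin m → F, x ≠ 0 ∧ ∀ A ∈ I, A *ᵥ x = 0 := by
  let U : Submodule F (Fin m → F) := Submodule.span F {r | ∃ A ∈ I, ∃ i, A i = r}
  have hsingle : ∀ r ∈ U, ∀ i, Matrix.vecMulVec (Pi.single i 1) r ∈ I := by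
    intro r hr i
    induction hr using Submodule.span_induction with
    | mem r hr =>
      obtain ⟨A, hA, j, rfl⟩ := hr
      have := I.mul_mem_left (Matrix.single i j 1) hA
      convert this
      ext k l
      by_cases hk : k = i
      · subst hk
        simp [Matrix.vecMulVec_apply]
      · simp [Matrix.vecMulVec_apply, hk]
    | zero => simp
    | add r s _ _ hr hs =>
      rw [Matrix.vecMulVec_add]
      exact add_mem hr hs
    | smul c r _ hr =>
      have := I.mul_mem_left (Matrix.scalar (Fin m) c) hr
      convert this using 1
      ext k l
      simp [Matrix.vecMulVec_apply]
      ring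
  have hU : U < ⊤ := by
    refine lt_top_iff_ne_top.2 fun h ↦ hI ?_
    rw [Ideal.eq_top_iff_one]
    have h1 : (1 : Matrix (Fin m) (Fin m) F) =
        ∑ i, Matrix.vecMulVec (Pi.single i 1) (Pi.single i 1) := by
      ext k l
      simp [Matrix.sum_apply, Matrix.vecMulVec_apply, Matrix.one_apply, Pi.single_apply]
    rw [h1]
    exact sum_mem fun i _ ↦ hsingle _ (h ▸ trivial) i
  obtain ⟨f, hf0, hf⟩ := Submodule.exists_le_ker_of_lt_top U hU
  refine ⟨fun i ↦ f (Pi.single i 1), fun h ↦ hf0 ?_, fun A hA ↦ ?_⟩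
  · refine LinearMap.pi_ext' fun i ↦ LinearMap.ext_ring ?_
    simpa using congrFun h i
  · ext i
    have h1 : f (A i) = 0 := hf (Submodule.subset_span ⟨A, hA, i, rfl⟩)
    rw [← (Pi.basisFun F (Fin m)).sum_repr (A i)] at h1
    simpa [Matrix.mulVec, dotProduct] using h1

variable {A : Type*} [Ring A] (red : A →+* Matrix (Fin m) (Fin m) F)

/-- The elements whose reduction kills a given line. -/
def lineIdeal (ℓ : ℙ F (Fin m → F)) : Ideal A where
  carrier := {x | red x *ᵥ ℓ.rep = 0}
  zero_mem' := by simp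
  add_mem' {x y} hx hy := by
    have h : red (x + y) *ᵥ ℓ.rep = 0 := by
      rw [map_add, Matrix.add_mulVec, hx, hy, add_zero]
    exact h
  smul_mem' c x hx := by
    have h : red (c * x) *ᵥ ℓ.rep = 0 := by
      rw [map_mul, ← Matrix.mulVec_mulVec, hx, Matrix.mulVec_zero]
    exact h

variable {red}

theorem mem_lineIdeal {ℓ : ℙ F (Fin m → F)} {x : A} : x ∈ lineIdeal red ℓ ↔ red x *ᵥ ℓ.rep = 0 :=
  Iff.rfl

theorem mem_lineIdeal_mk {y : Fin m → F} (hy : y ≠ 0) {x : A} :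
    x ∈ lineIdeal red (Projectivization.mk F y hy) ↔ red x *ᵥ y = 0 := by
  obtain ⟨c, hc⟩ := Projectivization.exists_smul_eq_mk_rep F y hy
  rw [mem_lineIdeal, ← hc, Units.smul_def, Matrix.mulVec_smul]
  simp

theorem lineIdeal_ne_top (ℓ : ℙ F (Fin m → F)) : lineIdeal red ℓ ≠ ⊤ := by
  rw [Ideal.ne_top_iff_one, mem_lineIdeal, map_one, Matrix.one_mulVec]
  exact ℓ.rep_nonzero

theorem lineIdeal_isMaximal (hred : Function.Surjective red) (ℓ : ℙ F (Fin m → F)) :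
    (lineIdeal red ℓ).IsMaximal := by
  refine ⟨⟨lineIdeal_ne_top ℓ, fun I hI ↦ ?_⟩⟩
  obtain ⟨x, hxI, hx⟩ := Set.exists_of_ssubset hI
  rw [Ideal.eq_top_iff_one]
  -- If `x` does not kill the line, some `c * x` fixes its representative, so `1 - c * x` lies in
  -- the line ideal.
  obtain ⟨C, hC⟩ := exists_mulVec_eq (x := red x *ᵥ ℓ.rep) hx ℓ.rep
  obtain ⟨c, rfl⟩ := hred C
  have h1 : 1 - c * x ∈ lineIdeal red ℓ := by
    rw [mem_lineIdeal, map_sub, map_one, map_mul, Matrix.sub_mulVec, ← Matrix.mulVec_mulVec, hC,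
      Matrix.one_mulVec, sub_self]
  have := add_mem (hI.le h1) (I.mul_mem_left c hxI)
  rwa [sub_add_cancel] at this

theorem exists_eq_lineIdeal (hred : Function.Surjective red) {P : Ideal A} (hP : P.IsMaximal)
    (hker : ∀ x, red x = 0 → x ∈ P) : ∃ ℓ, P = lineIdeal red ℓ := by
  have : RingHomSurjective red := ⟨hred⟩
  let I : Ideal (Matrix (Fin m) (Fin m) F) := Submodule.map red.toSemilinearMap P
  have hI : I ≠ ⊤ := by
    rw [Ideal.ne_top_iff_one]
    rintro ⟨p, hp, hp1⟩
    change red p = 1 at hp1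
    refine hP.ne_top ((Ideal.eq_top_iff_one P).2 ?_)
    have := hker (1 - p) (by rw [map_sub, map_one, hp1, sub_self])
    have := add_mem this hp
    rwa [sub_add_cancel] at this
  obtain ⟨y, hy, h⟩ := exists_mulVec_eq_zero_of_ne_top hI
  refine ⟨Projectivization.mk F y hy, hP.eq_of_le (lineIdeal_ne_top _) fun p hp ↦ ?_⟩
  rw [mem_lineIdeal_mk]
  exact h _ ⟨p, hp, rfl⟩

theorem lineIdeal_injective (hred : Function.Surjective red) :
    Function.Injective (lineIdeal red) := by
  intro ℓ ℓ' h
  obtain ⟨T, -, hT⟩ := exists_idempotent_ker_eq ℓ.submodule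
  obtain ⟨t, rfl⟩ := hred T
  have h1 : t ∈ lineIdeal red ℓ := by
    rw [mem_lineIdeal, ← Matrix.mulVecLin_apply, ← LinearMap.mem_ker, hT,
      Projectivization.submodule_eq]
    exact Submodule.mem_span_singleton_self _
  rw [h, mem_lineIdeal, ← Matrix.mulVecLin_apply, ← LinearMap.mem_ker, hT,
    Projectivization.submodule_eq, Submodule.mem_span_singleton] at h1
  obtain ⟨c, hc⟩ := h1
  rw [← ℓ.mk_rep, ← ℓ'.mk_rep, eq_comm, Projectivization.mk_eq_mk_iff']
  exact ⟨c, hc⟩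

/-- The image of the left ideal of a line is generated by a matrix whose kernel is the line. -/
theorem exists_map_lineIdeal_eq_span (hred : Function.Surjective red) (ℓ : ℙ F (Fin m → F)) :
    ∃ T : Matrix (Fin m) (Fin m) F, T.rank + 1 = m ∧
      Ideal.map red (lineIdeal red ℓ) = Ideal.span {T} ∧
      ℓ.submodule = LinearMap.ker T.mulVecLin := by
  obtain ⟨T, hTT, hT⟩ := exists_idempotent_ker_eq ℓ.submodule
  refine ⟨T, ?_, le_antisymm (Ideal.map_le_iff_le_comap.2 fun x hx ↦ ?_)
    ((Ideal.span_singleton_le_iff_mem _).2 ?_), hT.symm⟩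
  · have h1 := T.mulVecLin.finrank_range_add_finrank_ker
    rw [hT, ℓ.finrank_submodule, Module.finrank_fin_fun] at h1
    exact h1
  · rw [Ideal.mem_comap, Ideal.mem_span_singleton']
    refine ⟨red x, ?_⟩
    -- As `T` is idempotent, `y - T y` lies on the line, which `red x` kills; hence `red x = red x *
    -- T`.
    have h2 : ∀ y, red x *ᵥ (y - T *ᵥ y) = 0 := by
      intro y
      have : y - T *ᵥ y ∈ ℓ.submodule := by
        rw [← hT, LinearMap.mem_ker, Matrix.mulVecLin_apply, Matrix.mulVec_sub,
          Matrix.mulVec_mulVec, hTT, sub_self]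
      rw [Projectivization.submodule_eq, Submodule.mem_span_singleton] at this
      obtain ⟨c, hc⟩ := this
      rw [← hc, Matrix.mulVec_smul, mem_lineIdeal.1 hx, smul_zero]
    refine Matrix.ext_of_mulVec_single fun i ↦ ?_
    have := h2 (Pi.single i 1)
    rw [Matrix.mulVec_sub, sub_eq_zero, Matrix.mulVec_mulVec] at this
    exact this.symm
  · obtain ⟨t, rfl⟩ := hred T
    refine Ideal.mem_map_of_mem _ ?_
    rw [mem_lineIdeal, ← Matrix.mulVecLin_apply, ← LinearMap.mem_ker, hT,
      Projectivization.submodule_eq]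
    exact Submodule.mem_span_singleton_self _

end LineIdeal

/-! ### Norms of diagonal matrices, and units of orders. -/

section MatrixNorm

variable {K : Type*} [Field K] {D : Type*} [Ring D] [Algebra K D] [Module.Finite K D]

theorem norm_diagonal {m : ℕ} (d : Fin m → D) :
    Algebra.norm K (Matrix.diagonal d) = (∏ i, Algebra.norm K (d i)) ^ m := by
  let ε := (Matrix.ofLinearEquiv K : (Fin m → Fin m → D) ≃ₗ[K] Matrix (Fin m) (Fin m) D).symm
  have h : (ε : Matrix (Fin m) (Fin m) D →ₗ[K] _) ∘ₗ Algebra.lmul K _ (Matrix.diagonal d) ∘ₗ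
      (ε.symm : (Fin m → Fin m → D) →ₗ[K] _) =
      LinearMap.pi fun i ↦ (LinearMap.pi fun j ↦ (Algebra.lmul K D (d i)) ∘ₗ
        (LinearMap.proj j : (Fin m → D) →ₗ[K] D)) ∘ₗ LinearMap.proj i := by
    refine LinearMap.ext fun v ↦ ?_
    funext i j
    exact Matrix.diagonal_mul d (Matrix.of v) i j
  rw [Algebra.norm_apply, ← LinearMap.det_conj _ ε, h, LinearMap.det_pi]
  simp_rw [LinearMap.det_pi, Finset.prod_const, Finset.card_univ, Fintype.card_fin,
    Finset.prod_pow]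
  rfl

end MatrixNorm

theorem IsOrder.isLattice {K : Type u} [Field K] [ValuativeRel K] {B : Type v} [Ring B]
    [Algebra K B] {O : Subalgebra 𝒪[K] B} (hO : IsOrder K O) :
    Submodule.IsLattice K (Subalgebra.toSubmodule O) where
  fg := hO.1
  span_eq_top := hO.2

theorem mul_eq_one_symm_of_algEquiv_matrix {K D B : Type*} [Field K] [DivisionRing D]
    [Algebra K D] [Ring B] [Algebra K B] {m : ℕ} (e : B ≃ₐ[K] Matrix (Fin m) (Fin m) D) {x y : B}
    (h : x * y = 1) : y * x = 1 := by
  apply e.injective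
  rw [map_mul, map_one, mul_eq_one_comm, ← map_mul, h, map_one]

section OrderUnits

variable {K : Type u} [Field K] [ValuativeRel K] [TopologicalSpace K]
  [IsNonarchimedeanLocalField K] {B : Type v} [Ring B] [Algebra K B] {O : Subalgebra 𝒪[K] B}

theorem IsOrder.valuation_norm_le_one (hO : IsOrder K O) {x : B} (hx : x ∈ O) :
    valuation K (Algebra.norm K x) ≤ 1 := by
  have := hO.isLattice
  exact valuation_norm_le_one_of_stable K (Subalgebra.toSubmodule O) fun y hy ↦ O.mul_mem hx hy

theorem IsOrder.valuation_norm_unit (hO : IsOrder K O) (u : Oˣ) :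
    valuation K (Algebra.norm K ((u : O) : B)) = 1 := by
  refine le_antisymm (hO.valuation_norm_le_one (u : O).2) ?_
  have h1 : ((u : O) : B) * ((u⁻¹ : Oˣ) : O) = 1 := congrArg Subtype.val u.mul_inv
  have h2 : valuation K (Algebra.norm K ((u : O) : B)) *
      valuation K (Algebra.norm K (((u⁻¹ : Oˣ) : O) : B)) = 1 := by
    rw [← map_mul, ← map_mul, h1, map_one, map_one]
  rw [← h2]
  exact mul_le_of_le_one_right' (hO.valuation_norm_le_one ((u⁻¹ : Oˣ) : O).2)

/-- Multiplication by `x` on the lattice `O` has unit determinant, so it is onto and reaches `1`. -/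
theorem IsOrder.exists_mul_eq_one (hO : IsOrder K O) {x : B} (hx : x ∈ O)
    (h : valuation K (Algebra.norm K x) = 1) : ∃ y ∈ O, x * y = 1 := by
  have := hO.isLattice
  let f : Subalgebra.toSubmodule O →ₗ[𝒪[K]] Subalgebra.toSubmodule O :=
    (Algebra.lmul 𝒪[K] B x).restrict fun y hy ↦ O.mul_mem hx hy
  have hf := algebraMap_det_restrict (K := K) (Subalgebra.toSubmodule O) (Algebra.lmul K B x) f
    fun y ↦ rfl
  have hu : IsUnit (LinearMap.det f) := by
    rw [(Valuation.integer.integers (valuation K)).isUnit_iff_valuation_eq_one, hf]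
    exact h
  obtain ⟨y, hy⟩ := (LinearMap.equivOfIsUnitDet hu).surjective ⟨1, one_mem O⟩
  rw [LinearMap.equivOfIsUnitDet_apply] at hy
  have hy' : x * (y : B) = 1 := congrArg Subtype.val hy
  exact ⟨y, y.2, hy'⟩

end OrderUnits

/-! ### Radical and principal maximal left ideals of the integral matrix order. -/

section MatrixOrder

variable {K : Type u} [Field K] [ValuativeRel K] [TopologicalSpace K]
  [IsNonarchimedeanLocalField K]
  {D : Type v} [DivisionRing D] [Algebra K D] [FiniteDimensional K D]
  {B : Type v} [Ring B] [Algebra K B] {m : ℕ} (e : B ≃ₐ[K] Matrix (Fin m) (Fin m) D)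

/-- The order of integral matrices is a matrix ring over the valuation ring of `D`. -/
def integralMatrixOrderEquiv :
    integralMatrixOrder e ≃+* Matrix (Fin m) (Fin m) (divisionIntegers K D) where
  toFun x := Matrix.of fun i j ↦ ⟨e x i j, x.2 i j⟩
  invFun M := ⟨e.symm (M.map Subtype.val), fun i j ↦ by
    rw [e.apply_symm_apply]
    exact (M i j).2⟩
  left_inv x := Subtype.ext (e.symm_apply_apply x)
  right_inv M := by
    ext i j
    exact congrFun (congrFun (e.apply_symm_apply (M.map Subtype.val)) i) j
  map_mul' x y := by
    ext i j
    change e (x * y) i j = _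
    rw [map_mul, Matrix.mul_apply, Matrix.mul_apply, AddSubmonoidClass.coe_finsetSum]
    rfl
  map_add' x y := by
    ext i j
    change e (x + y) i j = _
    rw [map_add]
    rfl

variable {F : Type w} [Field F] (ρ : divisionIntegers K D →+* F)

/-- Entrywise reduction of integral matrices. -/
def matrixReduction : integralMatrixOrder e →+* Matrix (Fin m) (Fin m) F :=
  ρ.mapMatrix.comp (integralMatrixOrderEquiv e : integralMatrixOrder e →+* _)

variable {e}

theorem matrixReduction_apply (x : integralMatrixOrder e) (i j : Fin m) :
    matrixReduction e ρ x i j = ρ ⟨e x i j, x.2 i j⟩ := rfl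

variable {ρ}

theorem matrixReduction_surjective (hρ : Function.Surjective ρ) :
    Function.Surjective (matrixReduction e ρ) := by
  intro M
  choose r hr using fun i j ↦ hρ (M i j)
  refine ⟨(integralMatrixOrderEquiv e).symm (Matrix.of r), ?_⟩
  rw [matrixReduction, RingHom.comp_apply, RingEquiv.coe_toRingHom, RingEquiv.apply_symm_apply]
  ext i j
  exact hr i j

theorem matrixReduction_eq_zero_iff (hker : ∀ x, ρ x = 0 ↔ normValuation K D x < 1)
    {x : integralMatrixOrder e} :
    matrixReduction e ρ x = 0 ↔ ∀ i j, normValuation K D (e x i j) < 1 :=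
  ⟨fun h i j ↦ (hker _).1 (congrFun (congrFun h i) j), fun h ↦ by
    ext i j
    exact (hker _).2 (h i j)⟩

theorem mem_jacobson_divisionIntegers {x : divisionIntegers K D} (hx : normValuation K D x < 1) :
    x ∈ Ring.jacobson (divisionIntegers K D) := by
  rw [← Ideal.jacobson_bot, Ideal.mem_jacobson_iff]
  intro y
  have h1 : normValuation K D (y * x) < 1 := by
    rw [map_mul]
    exact mul_lt_one_of_nonneg_of_lt_one_right y.2 zero_le hx
  have h2 : normValuation K D (1 + y * x) = 1 := by
    rw [(normValuation K D).map_add_eq_of_lt_left (by rwa [map_one]), map_one]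
  have h0 : (1 + y * x : D) ≠ 0 := by
    intro h
    rw [h, map_zero] at h2
    exact zero_ne_one h2
  refine ⟨⟨(1 + y * x : D)⁻¹, by rw [mem_divisionIntegers, map_inv₀, h2, inv_one]⟩, ?_⟩
  rw [Ideal.mem_bot, sub_eq_zero]
  ext
  change (1 + y * x : D)⁻¹ * y * x + (1 + y * x : D)⁻¹ = 1
  rw [mul_assoc, ← mul_add_one, add_comm _ (1 : D), inv_mul_cancel₀ h0]

theorem mem_jacobson_integralMatrixOrder_iff (hρ : Function.Surjective ρ)
    (hker : ∀ x, ρ x = 0 ↔ normValuation K D x < 1) {x : integralMatrixOrder e} :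
    x ∈ Ring.jacobson (integralMatrixOrder e) ↔ matrixReduction e ρ x = 0 := by
  constructor
  · intro hx
    have : RingHomSurjective (matrixReduction e ρ) := ⟨matrixReduction_surjective hρ⟩
    have h := Ring.le_comap_jacobson (matrixReduction e ρ) hx
    rwa [Ideal.mem_comap, IsSemisimpleRing.jacobson_eq_bot, Ideal.mem_bot] at h
  · intro hx
    rw [matrixReduction_eq_zero_iff hker] at hx
    have h1 : integralMatrixOrderEquiv e x ∈
        Ring.jacobson (Matrix (Fin m) (Fin m) (divisionIntegers K D)) := by
      rw [← Ideal.jacobson_bot, ← Ideal.matrix_bot]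
      refine Ideal.matrix_jacobson_le _ fun i j ↦ ?_
      rw [Ideal.jacobson_bot]
      exact mem_jacobson_divisionIntegers (hx i j)
    have : RingHomSurjective ((integralMatrixOrderEquiv e).symm :
        Matrix (Fin m) (Fin m) (divisionIntegers K D) →+* integralMatrixOrder e) :=
      ⟨(integralMatrixOrderEquiv e).symm.surjective⟩
    have h2 := Ring.le_comap_jacobson ((integralMatrixOrderEquiv e).symm :
        Matrix (Fin m) (Fin m) (divisionIntegers K D) →+* integralMatrixOrder e) h1
    rw [Ideal.mem_comap] at h2
    simpa using h2

/-- Invertibility lifts through the radical, and one-sided inverses in matrices over `D` are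
two-sided. -/
theorem isUnit_of_isUnit_matrixReduction (hρ : Function.Surjective ρ)
    (hker : ∀ x, ρ x = 0 ↔ normValuation K D x < 1) {x : integralMatrixOrder e}
    {C : Matrix (Fin m) (Fin m) F} (hx : matrixReduction e ρ x * C = 1) : IsUnit x := by
  obtain ⟨y, rfl⟩ := matrixReduction_surjective (e := e) hρ C
  have h1 : x * y - 1 ∈ Ring.jacobson (integralMatrixOrder e) := by
    rw [mem_jacobson_integralMatrixOrder_iff hρ hker, map_sub, map_mul, hx, map_one, sub_self]
  rw [← Ideal.jacobson_bot, Ideal.mem_jacobson_iff] at h1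
  obtain ⟨z, hz⟩ := h1 1
  have h2 : z * x * y = 1 := by
    rw [Ideal.mem_bot, sub_eq_zero, mul_one, mul_sub, mul_one, sub_add_cancel] at hz
    rw [mul_assoc, hz]
  have h3 : y * z * x = 1 := by
    ext
    have := mul_eq_one_symm_of_algEquiv_matrix e (congrArg Subtype.val h2)
    exact (mul_assoc _ _ _).trans this
  have h4 : x * (y * z) = 1 := by
    ext
    exact mul_eq_one_symm_of_algEquiv_matrix e (congrArg Subtype.val h3)
  exact ⟨⟨x, y * z, h4, h3⟩, rfl⟩

/-- Translating by a unit moves the line to a coordinate axis `k`. The ideal then consists of the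
matrices whose column `k` is nonunital, that is, the left multiples of the diagonal matrix with `π`
in place `k` and `1` elsewhere. -/
theorem exists_generator_lineIdeal {ϖ : K} {f : ℕ} {π : D}
    (hπ0 : π ≠ 0) (hπ : normValuation K D π = valuation K ϖ ^ f) (hπ1 : normValuation K D π < 1)
    (hmax : ∀ x, normValuation K D x < 1 → normValuation K D x ≤ normValuation K D π)
    (hρ : Function.Surjective ρ) (hker : ∀ x, ρ x = 0 ↔ normValuation K D x < 1)
    (hO : IsOrder K (integralMatrixOrder e)) (ℓ : ℙ F (Fin m → F)) :
    ∃ β ∈ lineIdeal (matrixReduction e ρ) ℓ,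
      valuation K (Algebra.norm K (β : B)) = valuation K ϖ ^ (f * m) ∧
      ∀ x ∈ lineIdeal (matrixReduction e ρ) ℓ, ∃ z, x = z * β := by
  obtain ⟨k, hk⟩ := Function.ne_iff.1 ℓ.rep_nonzero
  -- Column `k` of the identity is replaced by the line's representative, so the determinant is its
  -- `k`-th coordinate, chosen nonzero.
  let U : Matrix (Fin m) (Fin m) F := (1 : Matrix (Fin m) (Fin m) F).updateCol k ℓ.rep
  have hdet : U.det = ℓ.rep k := by
    rw [← Matrix.cramer_apply, Matrix.cramer_one]
    rfl
  have hUk : U *ᵥ Pi.single k 1 = ℓ.rep := by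
    rw [Matrix.mulVec_single_one]
    ext i
    simp [U]
  obtain ⟨x, hx⟩ := matrixReduction_surjective (e := e) hρ U
  obtain ⟨u, rfl⟩ : IsUnit x := isUnit_of_isUnit_matrixReduction (C := U⁻¹) hρ hker (by
    rw [hx, Matrix.mul_nonsing_inv]
    rw [hdet]
    exact isUnit_iff_ne_zero.2 hk)
  let d : Fin m → D := Function.update 1 k π
  have hd : ∀ i, d i ≠ 0 := by
    intro i
    by_cases h : i = k
    · subst h
      simpa [d] using hπ0
    · simp [d, h]
  have hdle : ∀ i, normValuation K D (d i) ≤ 1 := by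
    intro i
    by_cases h : i = k
    · subst h
      simpa [d] using hπ1.le
    · simp [d, h]
  let β₀ : integralMatrixOrder e := ⟨e.symm (Matrix.diagonal d), fun i j ↦ by
    rw [e.apply_symm_apply, Matrix.diagonal_apply]
    split_ifs
    · exact hdle i
    · simp⟩
  have heβ₀ : e β₀ = Matrix.diagonal d := e.apply_symm_apply _
  have hmul (y : integralMatrixOrder e) : y * (u : integralMatrixOrder e) * (u⁻¹ : _ˣ) = y := by
    rw [mul_assoc, u.mul_inv, mul_one]
  refine ⟨β₀ * (u⁻¹ : _ˣ), ?_, ?_, fun x hx' ↦ ?_⟩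
  · have hu : ((u⁻¹ : _ˣ) : integralMatrixOrder e) * u = 1 := u.inv_mul
    rw [mem_lineIdeal, map_mul, ← hUk, ← hx, Matrix.mulVec_mulVec, mul_assoc, ← map_mul, hu,
      map_one, mul_one, Matrix.mulVec_single_one]
    ext i
    change matrixReduction e ρ β₀ i k = 0
    rw [matrixReduction_apply, hker]
    change normValuation K D (e β₀ i k) < 1
    rw [heβ₀, Matrix.diagonal_apply]
    split_ifs with h
    · subst h
      simpa [d] using hπ1
    · simp
  · have h1 : ((β₀ * (u⁻¹ : _ˣ) : integralMatrixOrder e) : B) =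
      (β₀ : B) * (((u⁻¹ : _ˣ) : integralMatrixOrder e) : B) := rfl
    have h2 : ∏ i, Algebra.norm K (d i) = Algebra.norm K π := by
      rw [Finset.prod_eq_single k]
      · simp [d]
      · intro i _ hi
        simp [d, hi]
      · simp
    rw [h1, map_mul, map_mul, hO.valuation_norm_unit, mul_one, ← norm_algEquiv e, heβ₀,
      norm_diagonal, h2, map_pow, ← normValuation_apply, hπ, pow_mul]
  · have hcol : ∀ i, normValuation K D (e (x * u : integralMatrixOrder e) i k) < 1 := by
      intro i
      rw [mem_lineIdeal, ← hUk, ← hx, Matrix.mulVec_mulVec, ← map_mul,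
        Matrix.mulVec_single_one] at hx'
      have := congrFun hx' i
      change matrixReduction e ρ (x * u) i k = 0 at this
      rwa [matrixReduction_apply, hker] at this
    -- The quotient of `x * u` by the diagonal matrix; column `k` stays integral because `π` has the
    -- largest value below `1`.
    let z : integralMatrixOrder e :=
      ⟨e.symm (Matrix.of fun i j ↦ e (x * u : integralMatrixOrder e) i j * (d j)⁻¹), fun i j ↦ by
        rw [e.apply_symm_apply, Matrix.of_apply, map_mul, map_inv₀]
        have hpos : 0 < normValuation K D (d j) :=
          zero_lt_iff.2 ((normValuation K D).ne_zero_iff.2 (hd j))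
        rw [← div_eq_mul_inv, div_le_one₀ hpos]
        by_cases h : j = k
        · subst h
          refine (hmax _ (hcol i)).trans_eq ?_
          simp [d]
        · refine ((x * u : integralMatrixOrder e).2 i j).trans_eq ?_
          simp [d, h]⟩
    have hz : z * β₀ = x * u := by
      ext
      apply e.injective
      change e (z * β₀) = _
      rw [map_mul, heβ₀, e.apply_symm_apply]
      ext i j
      rw [Matrix.mul_diagonal, Matrix.of_apply, inv_mul_cancel_right₀ (hd j)]
    refine ⟨z, ?_⟩
    rw [← mul_assoc, hz, hmul]

end MatrixOrder

/-! ### Left ideals of prime reduced norm are the maximal ones. -/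

section PrimeNorm

theorem mem_coeSubmodule_maximalIdeal_iff {K : Type*} [Field K] [ValuativeRel K] {c : K} :
    c ∈ IsLocalization.coeSubmodule K 𝓂[K] ↔ valuation K c < 1 := by
  have hlt (r : 𝒪[K]) : r ∈ 𝓂[K] ↔ valuation K (r : K) < 1 := by
    rw [IsLocalRing.mem_maximalIdeal, mem_nonunits_iff,
      (Valuation.integer.integers (valuation K)).isUnit_iff_valuation_eq_one]
    exact ⟨fun h ↦ lt_of_le_of_ne r.2 h, fun h ↦ h.ne⟩
  rw [IsLocalization.mem_coeSubmodule]
  exact ⟨by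
    rintro ⟨r, hr, rfl⟩
    exact (hlt r).1 hr, fun h ↦ ⟨⟨c, h.le⟩, (hlt _).2 h, rfl⟩⟩

theorem valuation_reducedNorm_pow {K : Type u} [Field K] [ValuativeRel K] {B : Type v} [Ring B]
    [Algebra K B] [FiniteDimensional K B] [Algebra.IsCentral K B] [IsSimpleRing B] {n : ℕ}
    (hn : n ^ 2 = Module.finrank K B) (x : B) :
    valuation K (reducedNorm K x) ^ n = valuation K (Algebra.norm K x) := by
  rw [← map_pow, reducedNorm_pow K hn]

theorem valuation_reducedNorm_mul {K : Type u} [Field K] [ValuativeRel K] {B : Type v} [Ring B]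
    [Algebra K B] [FiniteDimensional K B] [Algebra.IsCentral K B] [IsSimpleRing B] {n : ℕ}
    (hn0 : n ≠ 0) (hn : n ^ 2 = Module.finrank K B) (x y : B) :
    valuation K (reducedNorm K (x * y)) =
      valuation K (reducedNorm K x) * valuation K (reducedNorm K y) :=
  (pow_left_inj₀ zero_le zero_le hn0).1 (by
    rw [mul_pow, valuation_reducedNorm_pow hn, valuation_reducedNorm_pow hn,
      valuation_reducedNorm_pow hn, map_mul, map_mul])

variable {K : Type u} [Field K] [ValuativeRel K] [TopologicalSpace K]
  [IsNonarchimedeanLocalField K] {B : Type v} [Ring B] [Algebra K B] [FiniteDimensional K B]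
  [Algebra.IsCentral K B] [IsSimpleRing B] {O : Subalgebra 𝒪[K] B}

theorem valuation_le_of_lt_one {ϖ : 𝒪[K]} (hϖ : Irreducible ϖ) {c : K}
    (hc : valuation K c < 1) : valuation K c ≤ valuation K (ϖ : K) := by
  by_cases hc0 : c = 0
  · simp [hc0]
  obtain ⟨k, hk⟩ := exists_valuation_eq_pow hϖ hc0 hc.le
  rw [hk]
  conv_rhs => rw [← pow_one (valuation K (ϖ : K))]
  rw [valuation_irreducible_pow_le_iff hϖ]
  refine Nat.one_le_iff_ne_zero.2 ?_
  rintro rfl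
  rw [pow_zero] at hk
  exact hc.ne hk

theorem IsOrder.valuation_reducedNorm_le_one (hO : IsOrder K O) {n : ℕ} (hn0 : n ≠ 0)
    (hn : n ^ 2 = Module.finrank K B) {x : B} (hx : x ∈ O) :
    valuation K (reducedNorm K x) ≤ 1 := by
  rw [← pow_le_one_iff_of_nonneg zero_le hn0, valuation_reducedNorm_pow hn]
  exact hO.valuation_norm_le_one hx

/-- In an order whose maximal left ideals are generated by elements of prime reduced norm, the
left ideals of prime reduced norm are the maximal left ideals. -/
theorem mem_primeNormIdeals_iff (hO : IsOrder K O) {n : ℕ} (hn0 : n ≠ 0)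
    (hn : n ^ 2 = Module.finrank K B) {ϖ : 𝒪[K]} (hϖ : Irreducible ϖ)
    (hsymm : ∀ x y : B, x * y = 1 → y * x = 1)
    (hgen : ∀ M : Ideal O, M.IsMaximal → ∃ β ∈ M,
      valuation K (reducedNorm K (β : B)) = valuation K (ϖ : K) ∧ ∀ x ∈ M, ∃ z, x = z * β)
    {P : Ideal O} : P ∈ PrimeNormIdeals O ↔ P.IsMaximal := by
  have hϖ0 := valuation_irreducible_pos hϖ
  have hϖ1 := valuation_irreducible_lt_one hϖ
  have hmul := valuation_reducedNorm_mul (K := K) (B := B) hn0 hn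
  constructor
  · intro hP
    have hmem (x : O) (hx : x ∈ P) : valuation K (reducedNorm K (x : B)) < 1 := by
      rw [← mem_coeSubmodule_maximalIdeal_iff, ← show idealReducedNorm P = _ from hP]
      exact Submodule.subset_span ⟨x, hx, rfl⟩
    have htop : P ≠ ⊤ := by
      intro h
      have h1 := hmem 1 (h ▸ trivial)
      have h2 := valuation_reducedNorm_pow hn (1 : B)
      rw [map_one, map_one] at h2
      exact (pow_lt_one₀ zero_le h1 hn0).ne h2
    obtain ⟨M, hM, hPM⟩ := Ideal.exists_le_maximal P htop
    obtain ⟨β, hβM, hβ, hMβ⟩ := hgen M hM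
    -- Otherwise all reduced norms from `P`, and by the ultrametric inequality their span, would be
    -- strictly smaller than `ϖ`.
    obtain ⟨γ, hγP, hγ⟩ : ∃ γ ∈ P, valuation K (reducedNorm K (γ : B)) = valuation K (ϖ : K) := by
      by_contra! h
      have hlt : ∀ c ∈ idealReducedNorm P, valuation K c < valuation K (ϖ : K) := by
        intro c hc
        induction hc using Submodule.span_induction with
        | mem c hc =>
          obtain ⟨x, hx, rfl⟩ := hc
          exact lt_of_le_of_ne (valuation_le_of_lt_one hϖ (hmem x hx)) (h x hx)
        | zero => simpa using hϖ0
        | add c d _ _ hc hd => exact (valuation K).map_add_lt hc hd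
        | smul r c _ hc =>
          rw [Subring.smul_def, smul_eq_mul, map_mul]
          exact (mul_le_of_le_one_left' r.2).trans_lt hc
      refine (hlt ϖ ?_).ne rfl
      rw [show idealReducedNorm P = _ from hP, mem_coeSubmodule_maximalIdeal_iff]
      exact hϖ1
    obtain ⟨z, rfl⟩ := hMβ γ (hPM hγP)
    -- In `γ = z * β` both `γ` and `β` have the valuation of `ϖ`, so `z` is a unit of `O`. Then `β ∈
    -- P`, and `P` is the whole maximal ideal.
    have hz : valuation K (reducedNorm K (z : B)) = 1 := by
      have h1 : valuation K (reducedNorm K ((z : B) * β)) = valuation K (ϖ : K) := hγ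
      rw [hmul, hβ] at h1
      exact (mul_eq_right₀ hϖ0.ne').1 h1
    have hz' : valuation K (Algebra.norm K (z : B)) = 1 := by
      rw [← valuation_reducedNorm_pow hn, hz, one_pow]
    obtain ⟨y, hy, hzy⟩ := hO.exists_mul_eq_one z.2 hz'
    have hyz : (⟨y, hy⟩ : O) * z = 1 := Subtype.ext (hsymm _ _ hzy)
    have hβP : β ∈ P := by
      have := P.mul_mem_left ⟨y, hy⟩ hγP
      rwa [← mul_assoc, hyz, one_mul] at this
    have hMP : M ≤ P := fun x hx ↦ by
      obtain ⟨t, rfl⟩ := hMβ x hx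
      exact P.mul_mem_left t hβP
    rwa [le_antisymm hPM hMP]
  · intro hP
    obtain ⟨β, hβP, hβ, hPβ⟩ := hgen P hP
    refine le_antisymm (Submodule.span_le.2 ?_) fun c hc ↦ ?_
    · rintro _ ⟨x, hx, rfl⟩
      obtain ⟨z, rfl⟩ := hPβ x hx
      rw [SetLike.mem_coe, mem_coeSubmodule_maximalIdeal_iff]
      change valuation K (reducedNorm K ((z : B) * β)) < 1
      rw [hmul, hβ]
      exact (mul_le_of_le_one_left' (hO.valuation_reducedNorm_le_one hn0 hn z.2)).trans_lt hϖ1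
    · rw [mem_coeSubmodule_maximalIdeal_iff] at hc
      have hβ0 : reducedNorm K (β : B) ≠ 0 := by
        rw [← (valuation K).ne_zero_iff, hβ]
        exact hϖ0.ne'
      have h1 : valuation K (c * (reducedNorm K (β : B))⁻¹) ≤ 1 := by
        rw [map_mul, map_inv₀, hβ, ← div_eq_mul_inv, div_le_one₀ hϖ0]
        exact valuation_le_of_lt_one hϖ hc
      have h2 : c = (⟨_, h1⟩ : 𝒪[K]) • reducedNorm K (β : B) := by
        rw [Subring.smul_def, smul_eq_mul, inv_mul_cancel_right₀ hβ0]
      rw [h2]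
      exact Submodule.smul_mem _ _ (Submodule.subset_span ⟨β, hβP, rfl⟩)

end PrimeNorm

/-! ### The action of units on maximal left ideals. -/

section Metacommute

variable {K : Type u} [Field K] [ValuativeRel K] {B : Type v} [Ring B] [Algebra K B]
  {O : Subalgebra 𝒪[K] B}

/-- The summand `O 𝔭` adds nothing: it lies in the two-sided radical, so `O 𝔭 ω⁻¹` is already inside
the maximal ideal `P`. -/
theorem mem_metacommute_iff (hJ : ∀ r ∈ 𝓂[K], algebraMap 𝒪[K] O r ∈ Ring.jacobson O)
    {P : Ideal O} (hP : P.IsMaximal) (ω : Oˣ) {x : O} :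
    x ∈ metacommute (ω : O) P ↔ x * (ω⁻¹ : Oˣ) ∈ P := by
  constructor
  · have hle : metacommute (ω : O) P ≤
        Submodule.comap (LinearMap.toSpanSingleton O O ((ω⁻¹ : Oˣ) : O)) P := by
      refine sup_le ?_ (Ideal.map_le_iff_le_comap.2 fun r hr ↦ ?_)
      · rw [Submodule.map_le_iff_le_comap]
        intro p hp
        have : p * ω * (ω⁻¹ : Oˣ) ∈ P := by rwa [mul_assoc, ω.mul_inv, mul_one]
        exact this
      · have : algebraMap 𝒪[K] O r * (ω⁻¹ : Oˣ) ∈ P :=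
          Ring.jacobson_le_of_isMaximal P (Ideal.mul_mem_right _ _ (hJ r hr))
        exact this
    exact fun hx ↦ hle hx
  · intro hx
    refine Submodule.mem_sup_left ⟨_, hx, ?_⟩
    rw [LinearMap.toSpanSingleton_apply, smul_eq_mul, mul_assoc, ω.inv_mul, mul_one]

variable {F : Type w} [Field F] {m : ℕ}
  (φ : (O ⧸ Ring.jacobson O) ≃+* Matrix (Fin m) (Fin m) F)

theorem reduction_surjective : Function.Surjective (reduction φ) :=
  φ.surjective.comp Ideal.Quotient.mk_surjective

theorem reduction_eq_zero_iff {x : O} : reduction φ x = 0 ↔ x ∈ Ring.jacobson O := by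
  rw [← Ideal.Quotient.eq_zero_iff_mem, ← φ.map_eq_zero_iff]
  rfl

/-- `x ω⁻¹` kills `ℓ` iff `x` kills `ρ(ω)⁻¹ ℓ`; this is where the inverse in `tau` comes from. -/
theorem metacommute_lineIdeal (hJ : ∀ r ∈ 𝓂[K], algebraMap 𝒪[K] O r ∈ Ring.jacobson O)
    (ω : Oˣ) (ℓ : ℙ F (Fin m → F)) :
    metacommute (ω : O) (lineIdeal (reduction φ) ℓ) =
      lineIdeal (reduction φ) (tau (unitsReduction φ ω) ℓ) := by
  have hne : ((unitsReduction φ ω)⁻¹ : GL (Fin m) F).1 *ᵥ ℓ.rep ≠ 0 := by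
    intro h
    have := congrArg ((unitsReduction φ ω).1 *ᵥ ·) h
    simp only [Matrix.mulVec_mulVec, Matrix.mulVec_zero] at this
    rw [← Units.val_mul, mul_inv_cancel, Units.val_one, Matrix.one_mulVec] at this
    exact ℓ.rep_nonzero this
  have htau : tau (unitsReduction φ ω) ℓ = Projectivization.mk F _ hne := by
    conv_lhs => rw [← ℓ.mk_rep]
    exact tau_mk _ _ ℓ.rep_nonzero hne
  ext x
  rw [mem_metacommute_iff hJ (lineIdeal_isMaximal (reduction_surjective φ) ℓ), htau,
    mem_lineIdeal_mk, mem_lineIdeal, map_mul, ← Matrix.mulVec_mulVec]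
  rw [← map_inv]
  rfl

/-- Maximal left ideals correspond to lines. -/
def lineIdealEquiv {S : Set (Ideal O)} (hS : ∀ P, P ∈ S ↔ P.IsMaximal) :
    ℙ F (Fin m → F) ≃ S :=
  Equiv.ofBijective
    (fun ℓ ↦ ⟨lineIdeal (reduction φ) ℓ,
      (hS _).2 (lineIdeal_isMaximal (reduction_surjective φ) ℓ)⟩)
    ⟨fun _ _ h ↦ lineIdeal_injective (reduction_surjective φ) (congrArg Subtype.val h),
      fun P ↦ by
        have hP := (hS _).1 P.2
        obtain ⟨ℓ, hℓ⟩ := exists_eq_lineIdeal (reduction_surjective φ) hP fun x hx ↦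
          Ring.jacobson_le_of_isMaximal P.1 ((reduction_eq_zero_iff φ).1 hx)
        exact ⟨ℓ, Subtype.ext hℓ.symm⟩⟩

theorem coe_lineIdealEquiv {S : Set (Ideal O)} (hS : ∀ P, P ∈ S ↔ P.IsMaximal)
    (ℓ : ℙ F (Fin m → F)) : (lineIdealEquiv φ hS ℓ : Ideal O) = lineIdeal (reduction φ) ℓ := rfl

theorem eq_lineIdeal_lineIdealEquiv_symm {S : Set (Ideal O)} (hS : ∀ P, P ∈ S ↔ P.IsMaximal)
    (P : S) : (P : Ideal O) = lineIdeal (reduction φ) ((lineIdealEquiv φ hS).symm P) := by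
  rw [← coe_lineIdealEquiv φ hS, Equiv.apply_symm_apply]

theorem exists_perm_of_forall_mem_iff_isMaximal
    (hJ : ∀ r ∈ 𝓂[K], algebraMap 𝒪[K] O r ∈ Ring.jacobson O)
    (hS : ∀ P, P ∈ PrimeNormIdeals O ↔ P.IsMaximal)
    (φ : (O ⧸ Ring.jacobson O) ≃+* Matrix (Fin m) (Fin m) F) :
    ∃ σ : Oˣ → Equiv.Perm (PrimeNormIdeals O),
      (∀ (ω : Oˣ) (P : PrimeNormIdeals O), (σ ω P : Ideal O) = metacommute (ω : O) (P : Ideal O)) ∧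
      ∀ (m : ℕ) (F : Type*) [Field F] [Finite F]
        (φ : (O ⧸ Ring.jacobson O) ≃+* Matrix (Fin m) (Fin m) F),
        ∃ κ : PrimeNormIdeals O ≃ ℙ F (Fin m → F),
          (∀ P : PrimeNormIdeals O, ∃ A : Matrix (Fin m) (Fin m) F,
            A.rank + 1 = m ∧
            Ideal.map (reduction φ) (P : Ideal O) = Ideal.span {A} ∧
            (κ P).submodule = LinearMap.ker A.mulVecLin) ∧
          ∀ ω : Oˣ, κ.permCongr (σ ω) = tau (unitsReduction φ ω) := by
  have hσ (ω : Oˣ) (P : PrimeNormIdeals O) :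
      ((lineIdealEquiv φ hS).permCongr (tau (unitsReduction φ ω)) P : Ideal O) =
        metacommute (ω : O) (P : Ideal O) := by
    rw [Equiv.permCongr_apply, coe_lineIdealEquiv, ← metacommute_lineIdeal φ hJ,
      ← eq_lineIdeal_lineIdealEquiv_symm φ hS]
  -- The auxiliary `φ` only shows that the map is bijective. The values of `σ` are given by
  -- `metacommute`, so the comparison works for every other `φ'`.
  refine ⟨fun ω ↦ (lineIdealEquiv φ hS).permCongr (tau (unitsReduction φ ω)), hσ, ?_⟩
  intro m' F' _ _ φ'
  refine ⟨(lineIdealEquiv φ' hS).symm, fun P ↦ ?_, fun ω ↦ Equiv.ext fun ℓ ↦ ?_⟩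
  · obtain ⟨T, hT1, hT2, hT3⟩ := exists_map_lineIdeal_eq_span (reduction_surjective φ')
      ((lineIdealEquiv φ' hS).symm P)
    rw [← eq_lineIdeal_lineIdealEquiv_symm φ' hS] at hT2
    exact ⟨T, hT1, hT2, hT3⟩
  · rw [Equiv.permCongr_apply, Equiv.symm_symm, Equiv.symm_apply_eq]
    refine Subtype.ext ?_
    rw [hσ, coe_lineIdealEquiv, coe_lineIdealEquiv, metacommute_lineIdeal φ' hJ]

end Metacommute

end

end Metacommutation

/-! ### Assembly of the main theorem. -/

theorem theorem1
    (K : Type u) [Field K] [ValuativeRel K] [TopologicalSpace K] [IsNonarchimedeanLocalField K]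
    (B : Type v) [Ring B] [Algebra K B] [FiniteDimensional K B] [Algebra.IsCentral K B]
    [IsSimpleRing B]
    (O : Subalgebra 𝒪[K] B) (hO : Metacommutation.IsMaximalOrder K O) :
    -- `O / J` is a matrix ring over a finite extension of the residue field,
    -- of the same size `m` as the one for which `B` is a matrix ring over a division algebra
    (∃ (m : ℕ) (D : Type v) (_ : DivisionRing D) (_ : Algebra K D)
        (_ : B ≃ₐ[K] Matrix (Fin m) (Fin m) D)
        (F : Type v) (_ : Field F) (_ : Finite F) (_ : Algebra 𝓀[K] F)
        (φ : (O ⧸ Ring.jacobson O) ≃+* Matrix (Fin m) (Fin m) F),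
        0 < m ∧ ∀ r : 𝒪[K], Metacommutation.reduction φ (algebraMap 𝒪[K] O r) =
          Matrix.scalar (Fin m) (algebraMap 𝓀[K] F (IsLocalRing.residue 𝒪[K] r))) ∧
    -- `P ↦ P ω + O 𝔭` is a permutation `σ ω` of the left ideals of reduced norm `𝔭`
    ∃ σ : Oˣ → Equiv.Perm (Metacommutation.PrimeNormIdeals O),
      (∀ (ω : Oˣ) (P : Metacommutation.PrimeNormIdeals O),
        (σ ω P : Ideal O) = Metacommutation.metacommute (ω : O) (P : Ideal O)) ∧
      -- for every identification of `O / J` with a matrix ring over a finite field ...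
      ∀ (m : ℕ) (F : Type w) [Field F] [Finite F]
        (φ : (O ⧸ Ring.jacobson O) ≃+* Matrix (Fin m) (Fin m) F),
        -- ... kernels of reductions give a bijection `κ` with projective space ...
        ∃ κ : Metacommutation.PrimeNormIdeals O ≃ ℙ F (Fin m → F),
          (∀ P : Metacommutation.PrimeNormIdeals O, ∃ A : Matrix (Fin m) (Fin m) F,
            A.rank + 1 = m ∧
            Ideal.map (Metacommutation.reduction φ) (P : Ideal O) = Ideal.span {A} ∧
            (κ P).submodule = LinearMap.ker A.mulVecLin) ∧
          -- ... which carries `σ ω` to `τ (ρ ω)`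
          ∀ ω : Oˣ, κ.permCongr (σ ω) =
            Metacommutation.tau (Metacommutation.unitsReduction φ ω) := by
  have := IsArtinianRing.of_finite K B
  obtain ⟨m, hm, D, _, _, _, ⟨e₀⟩⟩ :=
    IsSimpleRing.exists_algEquiv_matrix_divisionRing_finite K B
  have := Metacommutation.isCentral_of_matrix K D m (Algebra.IsCentral.of_algEquiv K _ _ e₀)
  obtain ⟨e, rfl⟩ := hO.exists_eq_integralMatrixOrder e₀
  have hord := hO.prop
  obtain ⟨ϖ, hϖ⟩ := IsDiscreteValuationRing.exists_irreducible 𝒪[K]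
  have hϖ0 := Metacommutation.valuation_irreducible_pos hϖ
  have hϖ1 := Metacommutation.valuation_irreducible_lt_one hϖ
  obtain ⟨π, n, f, hn, hf, hfn, hπ, hmax, F, _, _, _, ρ, hρ, hker, hcompat⟩ :=
    Metacommutation.exists_uniformizer_residueField K D hϖ
  have hπ0 : π ≠ 0 := by
    rintro rfl
    rw [map_zero] at hπ
    exact (pow_pos hϖ0 f).ne hπ
  have hπ1 : Metacommutation.normValuation K D π < 1 := by
    rw [hπ]
    exact pow_lt_one₀ zero_le hϖ1 hf.ne'
  have hred := Metacommutation.matrixReduction_surjective (e := e) hρ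
  have hjac := fun x ↦
    Metacommutation.mem_jacobson_integralMatrixOrder_iff (e := e) hρ hker (x := x)
  let φ : (Metacommutation.integralMatrixOrder e ⧸
      Ring.jacobson (Metacommutation.integralMatrixOrder e)) ≃+* Matrix (Fin m) (Fin m) F :=
    RingEquiv.ofBijective (Ideal.Quotient.lift _ (Metacommutation.matrixReduction e ρ)
      fun x hx ↦ (hjac x).1 hx) ⟨by
        rw [injective_iff_map_eq_zero]
        intro x
        obtain ⟨x, rfl⟩ := Ideal.Quotient.mk_surjective x
        intro hx
        exact Ideal.Quotient.eq_zero_iff_mem.2 ((hjac x).2 hx), fun y ↦ by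
        obtain ⟨x, rfl⟩ := hred y
        exact ⟨Ideal.Quotient.mk _ x, rfl⟩⟩
  have hφ : ∀ r : 𝒪[K], Metacommutation.reduction φ (algebraMap 𝒪[K] _ r) =
      Matrix.scalar (Fin m) (algebraMap 𝓀[K] F (IsLocalRing.residue 𝒪[K] r)) := by
    intro r
    ext i j
    change Metacommutation.matrixReduction e ρ (algebraMap 𝒪[K] _ r) i j = _
    have h1 : e (algebraMap 𝒪[K] B r) = algebraMap K _ (r : K) := e.commutes _
    rw [Metacommutation.matrixReduction_apply, Matrix.scalar_apply, Matrix.diagonal_apply]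
    split_ifs with h
    · rw [← hcompat]
      congr 1
      ext
      change e (algebraMap 𝒪[K] B r) i j = _
      rw [h1, Matrix.algebraMap_matrix_apply, if_pos h]
      rfl
    · rw [hker]
      change Metacommutation.normValuation K D (e (algebraMap 𝒪[K] B r) i j) < 1
      rw [h1, Matrix.algebraMap_matrix_apply, if_neg h, map_zero]
      exact zero_lt_one
  refine ⟨⟨m, D, _, _, e, F, _, ‹_›, _, φ, Nat.pos_of_ne_zero hm.out, hφ⟩, ?_⟩
  have hJ : ∀ r ∈ 𝓂[K], algebraMap 𝒪[K] (Metacommutation.integralMatrixOrder e) r ∈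
      Ring.jacobson (Metacommutation.integralMatrixOrder e) := by
    intro r hr
    rw [← Metacommutation.reduction_eq_zero_iff φ, hφ, (IsLocalRing.residue_eq_zero_iff r).2 hr,
      map_zero, map_zero]
  have hdim : (m * n) ^ 2 = Module.finrank K B := by
    rw [e.toLinearEquiv.finrank_eq, Module.finrank_matrix, ← hn, Fintype.card_fin]
    ring
  have hn0 : n ≠ 0 := (hf.trans_le hfn).ne'
  have hmn : m * n ≠ 0 := mul_ne_zero hm.out hn0
  refine Metacommutation.exists_perm_of_forall_mem_iff_isMaximal hJ (fun P ↦
    Metacommutation.mem_primeNormIdeals_iff hord hmn hdim hϖ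
      (fun x y ↦ Metacommutation.mul_eq_one_symm_of_algEquiv_matrix e) fun M hM ↦ ?_) φ
  obtain ⟨ℓ, rfl⟩ := Metacommutation.exists_eq_lineIdeal hred hM fun x hx ↦
    Ring.jacobson_le_of_isMaximal M ((hjac x).2 hx)
  obtain ⟨β, hβM, hβ, hβgen⟩ := Metacommutation.exists_generator_lineIdeal hπ0 hπ hπ1 hmax hρ hker
    hord ℓ
  refine ⟨β, hβM, ?_, hβgen⟩
  rw [← Metacommutation.valuation_reducedNorm_pow hdim] at hβ
  have hβ0 : Metacommutation.reducedNorm K (β : B) ≠ 0 := by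
    intro h
    rw [h, map_zero, zero_pow hmn] at hβ
    exact (pow_pos hϖ0 _).ne hβ
  obtain ⟨k, hk⟩ := Metacommutation.exists_valuation_eq_pow hϖ hβ0
    (hord.valuation_reducedNorm_le_one hmn hdim β.2)
  rw [hk, ← pow_mul] at hβ
  -- Here `k` is the exponent of the reduced norm of the generator `β`. From `k * n = f`, `0 < f`
  -- and `f ≤ n` it follows that `k = 1`.
  have h1 : k * (m * n) = f * m := Metacommutation.valuation_irreducible_pow_inj hϖ hβ
  have h2 : k * n = f := by
    refine Nat.eq_of_mul_eq_mul_right (Nat.pos_of_ne_zero hm.out) ?_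
    rw [← h1]
    ring
  have h3 : k = 1 := by
    refine le_antisymm ?_ (Nat.one_le_iff_ne_zero.2 ?_)
    · refine Nat.le_of_mul_le_mul_right ?_ (Nat.pos_of_ne_zero hn0)
      rw [h2, one_mul]
      exact hfn
    · rintro rfl
      rw [zero_mul] at h2
      exact hf.ne h2
  rw [hk, h3, pow_one]
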